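/- Let $R$ be a commutative ring and $M$ an $R$-bimodule. For a ring $S$ let $\mathcal{B}(R,S)$ be the abelian category of functors $F$ from finitely generated projective $R$-modules to left $S$-modules with $F(0)=0$, and put $\mathcal{B}(R)=\mathcal{B}(R,R)$. Let $\mathsf{I}\in\mathcal{B}(R)$ be the tautological embedding, and $\mathsf{I}(M)(V)=M\otimes_R V$. An elementary extension of $R$ by $M$ is an exact sequence $$0\to \mathsf{I}(M)\xrightarrow{\,b\,} C_1\xrightarrow{\,d\,} C_0\xrightarrow{\,a\,}\mathsf{I}\to 0$$ in $\mathcal{B}(R)$. For commutative $S$, a multiplicative structure on a complex $F_\bullet$ in $\mathcal{B}(R,S)$ consists of a unit map $S\to F_0(R)$ and functorial maps of complexes $F_\bullet(V)\otimes_S F_\bullet(V')\to F_\bullet(V\otimes_R V')$, associative and unital. The extension $\phi=\langle C_\bullet,a,b\rangle$ is multiplicative if $C_\bullet=(C_1\xrightarrow{d}C_0)$ is equipped with a multiplicative structure such that $a:C_\bullet\to\mathsf{I}$ is multiplicative. For a ring map $f:S\to R$, restriction of scalars of the values gives an exact sequence $f_*(\phi)$ in $\mathcal{B}(R,S)$,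 multiplicative (with the same products) if $\phi$ is and $S$ is commutative. A splitting of $f_*(\phi)$ is a functor $C_{01}\in\mathcal{B}(R,S)$ with maps $c_1:f_*C_1\to C_{01}$ and $c_0:C_{01}\to f_*C_0$ such that $c_0$ is surjective, $c_0c_1=d$, and $c_1$ identifies $f_*C_1$ with $c_0^{-1}(\operatorname{Im} d)$. A multiplicative structure on this splitting is a multiplicative structure on the complex $C_1\xrightarrow{c_1}C_{01}$ (with $C_{01}$ in degree $0$) for which the map of complexes $(\mathrm{id},c_0)$ to $(C_1\xrightarrow{d}C_0)$ is multiplicative. Let $\phi$ be a multiplicative elementary extension of $R$ by $M$, and let $e:\mathbb{Z}\to R$ be the unique ring map. Then $e_*(\phi)$ admits a splitting, and for every splitting $\langle C_{01},c_0,c_1\rangle$ of $e_*(\phi)$ the following holds. Let $R'\subset\operatorname{End}(C_{01})$ be the ring of all endomorphisms $r'$ such that, for some (necessarily unique) $r\in R$, one has $r'c_1=c_1 r$ and $c_0r'=r\,c_0$. Let $q:R'\to R$, $r'\mapsto r$, and let $i:M\to R'$ send $m$ to the composition of $a\circ c_0:C_{01}\to\mathsf{I}$, of $v\mapsto m\otimes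 v$, and of $c_1\circ b:\mathsf{I}(M)\to C_{01}$. Then: 1. $0\to M\xrightarrow{\,i\,}R'\xrightarrow{\,q\,}R\to0$ is a square-zero extension of $R$ by the bimodule $M$, that is, the sequence is exact, $i(m)r'=i(m\,q(r'))$, $r'i(m)=i(q(r')m)$ and $i(m)i(m')=0$ for all $m,m'\in M$, $r'\in R'$. 2. The ring $R'$ is commutative. 3. The splitting $C_{01}$ of $e_*(\phi)$ admits a multiplicative structure; and every multiplicative structure on it extends to $q_*(\phi)$: the functor $C_{01}$, with the tautological action of $R'$ on its values, is a splitting of $q_*(\phi)$ in $\mathcal{B}(R,R')$ with the same maps $c_0$, $c_1$, and it carries a multiplicative structure over $R'$ with the same products and the same unit element of $C_{01}(R)$. -/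

import Mathlib

open CategoryTheory MonoidalCategory MulOpposite
open scoped TensorProduct

universe u w

noncomputable section

/-! ### Finitely generated projective modules and functors on them -/

section Functors

/-- The property of being a finitely generated projective module. -/
def fgProj (R : Type u) [CommRing R] : ObjectProperty (ModuleCat.{u} R) :=
  fun V => Module.Finite R V ∧ Module.Projective R V

instance fgProj_isMonoidal (R : Type u) [CommRing R] : (fgProj R).IsMonoidal where
  prop_unit := ⟨inferInstanceAs (Module.Finite R R), inferInstanceAs (Module.Projective R R)⟩
  prop_tensor := by
    rintro V W ⟨hV, hV'⟩ ⟨hW, hW'⟩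
    exact ⟨inferInstanceAs (Module.Finite R (V ⊗[R] W)),
      inferInstanceAs (Module.Projective R (V ⊗[R] W))⟩

/-- The tensor category `R-proj` of finitely generated projective modules over a commutative
ring `R`. Its unit object `𝟙_` is `R`. -/
abbrev FGProj (R : Type u) [CommRing R] := (fgProj R).FullSubcategory

/-- Functors from `R-proj` to left `S`-modules. -/
abbrev ProjFunctor (R : Type u) [CommRing R] (S : Type w) [Ring S] :=
  FGProj R ⥤ ModuleCat.{u} S

variable {R : Type u} [CommRing R]

/-- A functor is pointed if it sends zero modules to zero modules. The pointed functors
`R-proj ⥤ S-mod` are the objects of the category `B(R, S)`; a sequence of them is exact if and only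
if it is exact at every object of `R-proj`. -/
def IsPointed {S : Type w} [Ring S] (F : ProjFunctor R S) : Prop :=
  ∀ V : FGProj R, Subsingleton V.obj → Subsingleton (F.obj V)

/-- Postcomposition with restriction of scalars along `f : S' → S`. -/
abbrev restr {S : Type*} [Ring S] {S' : Type*} [Ring S'] (f : S' →+* S)
    (F : ProjFunctor R S) : ProjFunctor R S' :=
  F ⋙ ModuleCat.restrictScalars f

/-- The effect of restriction of scalars on a natural transformation. -/
abbrev restrMap {S : Type*} [Ring S] {S' : Type*} [Ring S'] (f : S' →+* S)
    {F G : ProjFunctor R S} (t : F ⟶ G) : restr f F ⟶ restr f G :=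
  Functor.whiskerRight t (ModuleCat.restrictScalars f)

variable (R) in
/-- The tautological embedding `I : R-proj ⥤ R-mod`. -/
abbrev tautFunctor : ProjFunctor R R := (fgProj R).ι

/-- A module over the commutative ring `R`, considered as a module over `Rᵐᵒᵖ`. -/
abbrev opModule (V : ModuleCat.{u} R) : ModuleCat.{u} Rᵐᵒᵖ :=
  (ModuleCat.restrictScalars ((RingEquiv.toOpposite R).symm : Rᵐᵒᵖ →+* R)).obj V

section Bimodule

variable (M : Type u) [AddCommGroup M] [Module R M] [Module Rᵐᵒᵖ M]

/-- The tensor product `M ⊗_R V` of an `R`-bimodule `M` and an `R`-module `V`: the tensor product is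
formed with respect to the right action of `R` on `M`. -/
abbrev BimodTensor (V : ModuleCat.{u} R) : Type u := M ⊗[Rᵐᵒᵖ] (opModule V)

/-- The element `m ⊗ v` of `M ⊗_R V`. -/
abbrev bimodTmul {V : ModuleCat.{u} R} (m : M) (v : V) : BimodTensor M V :=
  TensorProduct.tmul Rᵐᵒᵖ (N := opModule V) m v

variable [SMulCommClass R Rᵐᵒᵖ M]

/-- The left `R`-module structure on `M ⊗_R V`, `r • (m ⊗ v) = (r • m) ⊗ v`. -/
instance bimodTensorModule (V : ModuleCat.{u} R) : Module R (BimodTensor M V) :=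
  haveI : SMulCommClass Rᵐᵒᵖ R M := SMulCommClass.symm R Rᵐᵒᵖ M
  TensorProduct.leftModule

theorem smul_bimodTmul {V : ModuleCat.{u} R} (r : R) (m : M) (v : V) :
    r • bimodTmul M m v = bimodTmul M (r • m) v :=
  haveI : SMulCommClass Rᵐᵒᵖ R M := SMulCommClass.symm R Rᵐᵒᵖ M
  TensorProduct.smul_tmul' r m _

/-- The map `m ⊗ v ↦ m ⊗ g(v)`. -/
def bimodMap {V W : ModuleCat.{u} R} (g : V ⟶ W) : BimodTensor M V →ₗ[R] BimodTensor M W where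
  toFun := LinearMap.lTensor M
    ((ModuleCat.restrictScalars ((RingEquiv.toOpposite R).symm : Rᵐᵒᵖ →+* R)).map g).hom
  map_add' := map_add _
  map_smul' r x := by
    induction x using TensorProduct.induction_on with
    | zero => simp
    | tmul m v => exact congrArg _ (smul_bimodTmul M r m v)
    | add x y hx hy => rw [smul_add, map_add, hx, hy, map_add, smul_add]

variable (R) in
/-- The functor `I(M)`, `V ↦ M ⊗_R V`, of an `R`-bimodule `M`. -/
def bimodFunctor : ProjFunctor R R where
  obj V := ModuleCat.of R (BimodTensor M V.obj)
  map g := ModuleCat.ofHom (bimodMap M g.hom)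
  map_id V := by
    refine ModuleCat.hom_ext (LinearMap.ext fun x => ?_)
    exact LinearMap.congr_fun (LinearMap.lTensor_id M (opModule V.obj)) x
  map_comp {U V W} f g := by
    refine ModuleCat.hom_ext (LinearMap.ext fun x => ?_)
    exact LinearMap.congr_fun (LinearMap.lTensor_comp (R := Rᵐᵒᵖ) M
      ((ModuleCat.restrictScalars ((RingEquiv.toOpposite R).symm : Rᵐᵒᵖ →+* R)).map g.hom).hom
      ((ModuleCat.restrictScalars ((RingEquiv.toOpposite R).symm : Rᵐᵒᵖ →+* R)).map f.hom).hom) x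

/-- The map `v ↦ m ⊗ v` from `V` to `I(M)(V) = M ⊗_R V`. -/
def bimodMk {M : Type u} [AddCommGroup M] [Module R M] [Module Rᵐᵒᵖ M] [SMulCommClass R Rᵐᵒᵖ M]
    (m : M) (V : FGProj R) : V.obj →+ (bimodFunctor R M).obj V :=
  AddMonoidHom.mk' (fun v => bimodTmul M (V := V.obj) m v) fun _ _ => TensorProduct.tmul_add m _ _

end Bimodule

end Functors

/-! ### Elementary extensions and their splittings -/

section Extensions

variable {R : Type u} [CommRing R] {S : Type w} [Ring S]

/-- An elementary extension of `A` by `B` in the category `B(R, S)` of pointed functors: a complex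
`d : C₁ ⟶ C₀` of pointed functors with an exact sequence `0 → B → C₁ → C₀ → A → 0`. -/
structure ElemExt (A B : ProjFunctor R S) where
  C₁ : ProjFunctor R S
  C₀ : ProjFunctor R S
  pointed₁ : IsPointed C₁
  pointed₀ : IsPointed C₀
  b : B ⟶ C₁
  d : C₁ ⟶ C₀
  a : C₀ ⟶ A
  b_injective : ∀ V, Function.Injective (b.app V).hom
  exact₁ : ∀ V, Function.Exact (b.app V).hom (d.app V).hom
  exact₀ : ∀ V, Function.Exact (d.app V).hom (a.app V).hom
  a_surjective : ∀ V, Function.Surjective (a.app V).hom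

/-- The elementary extension obtained by applying restriction of scalars pointwise. -/
def ElemExt.restrict {S' : Type*} [Ring S'] (f : S' →+* S) {A B : ProjFunctor R S}
    (φ : ElemExt A B) : ElemExt (restr f A) (restr f B) where
  C₁ := restr f φ.C₁
  C₀ := restr f φ.C₀
  pointed₁ := φ.pointed₁
  pointed₀ := φ.pointed₀
  b := restrMap f φ.b
  d := restrMap f φ.d
  a := restrMap f φ.a
  b_injective := φ.b_injective
  exact₁ := φ.exact₁
  exact₀ := φ.exact₀
  a_surjective := φ.a_surjective

/-- A splitting of an elementary extension: an object `X` (usually denoted `C₀₁`) and maps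
`c₁ : C₁ ⟶ X`, `c₀ : X ⟶ C₀` such that `c₀ ∘ c₁ = d`, the resulting square with vertices
`C₁`, `X`, `Im d`, `C₀` is cartesian, and `c₀` is surjective. Equivalently, `X` carries a three-step
filtration `W₀ ⊆ W₁ ⊆ X` with `W₁ ≅ C₁`, `X / W₀ ≅ C₀`, `W₀ = B`, inducing `d : C₁ ⟶ C₀`. -/
structure ElemExt.Splitting {A B : ProjFunctor R S} (φ : ElemExt A B) where
  X : ProjFunctor R S
  pointed : IsPointed X
  c₁ : φ.C₁ ⟶ X
  c₀ : X ⟶ φ.C₀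
  comp : c₁ ≫ c₀ = φ.d
  cartesian : ∀ (V : FGProj R) (x : X.obj V),
    (c₀.app V).hom x ∈ Set.range (φ.d.app V).hom → ∃! c : φ.C₁.obj V, (c₁.app V).hom c = x
  c₀_surjective : ∀ V, Function.Surjective (c₀.app V).hom

end Extensions

/-! ### Multiplicative structures -/

section Multiplicative

variable {R : Type u} [CommRing R] {S : Type w} [Ring S]

/-- A multiplicative structure on a functor `F : R-proj ⥤ S-mod`, for a commutative ring `S`:
a unit `1 ∈ F(R)`, that is, an `S`-linear map `S → F(R)`, and functorial `S`-bilinear maps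
`F(V) × F(W) → F(V ⊗ W)`, that is, `F(V) ⊗_S F(W) → F(V ⊗ W)`, associative and unital. (The
commutativity of `S` is not needed to write this down, so it is not an instance argument.) -/
structure FunctorMul (F : ProjFunctor R S) where
  one : F.obj (𝟙_ (FGProj R))
  mul : ∀ V W : FGProj R, F.obj V →+ F.obj W →+ F.obj (V ⊗ W)
  smul_mul : ∀ V W (s : S) (x : F.obj V) (y : F.obj W), mul V W (s • x) y = s • mul V W x y
  mul_smul : ∀ V W (s : S) (x : F.obj V) (y : F.obj W), mul V W x (s • y) = s • mul V W x y
  map_mul : ∀ {V V' W W' : FGProj R} (f : V ⟶ V') (g : W ⟶ W') (x : F.obj V) (y : F.obj W),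
    (F.map (f ⊗ₘ g)).hom (mul V W x y) = mul V' W' ((F.map f).hom x) ((F.map g).hom y)
  assoc : ∀ (U V W : FGProj R) (x : F.obj U) (y : F.obj V) (z : F.obj W),
    (F.map (α_ U V W).hom).hom (mul (U ⊗ V) W (mul U V x y) z) = mul U (V ⊗ W) x (mul V W y z)
  one_mul : ∀ V (x : F.obj V), (F.map (λ_ V).hom).hom (mul (𝟙_ _) V one x) = x
  mul_one : ∀ V (x : F.obj V), (F.map (ρ_ V).hom).hom (mul V (𝟙_ _) x one) = x

/-- A multiplicative structure (a DG algebra structure) on a complex `d : F₁ ⟶ F₀` of functors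
concentrated in homological degrees `1` and `0`. Products of two elements of degree `1` lie in
degree `2`, hence vanish; the Leibniz rule for such a product is `leibniz₁₁`. -/
structure ComplexMul {F₁ F₀ : ProjFunctor R S} (d : F₁ ⟶ F₀) extends FunctorMul F₀ where
  mul₀₁ : ∀ V W : FGProj R, F₀.obj V →+ F₁.obj W →+ F₁.obj (V ⊗ W)
  mul₁₀ : ∀ V W : FGProj R, F₁.obj V →+ F₀.obj W →+ F₁.obj (V ⊗ W)
  smul_mul₀₁ : ∀ V W (s : S) (x : F₀.obj V) (c : F₁.obj W),
    mul₀₁ V W (s • x) c = s • mul₀₁ V W x c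
  mul₀₁_smul : ∀ V W (s : S) (x : F₀.obj V) (c : F₁.obj W),
    mul₀₁ V W x (s • c) = s • mul₀₁ V W x c
  smul_mul₁₀ : ∀ V W (s : S) (c : F₁.obj V) (x : F₀.obj W),
    mul₁₀ V W (s • c) x = s • mul₁₀ V W c x
  mul₁₀_smul : ∀ V W (s : S) (c : F₁.obj V) (x : F₀.obj W),
    mul₁₀ V W c (s • x) = s • mul₁₀ V W c x
  map_mul₀₁ : ∀ {V V' W W' : FGProj R} (f : V ⟶ V') (g : W ⟶ W') (x : F₀.obj V) (c : F₁.obj W),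
    (F₁.map (f ⊗ₘ g)).hom (mul₀₁ V W x c) = mul₀₁ V' W' ((F₀.map f).hom x) ((F₁.map g).hom c)
  map_mul₁₀ : ∀ {V V' W W' : FGProj R} (f : V ⟶ V') (g : W ⟶ W') (c : F₁.obj V) (x : F₀.obj W),
    (F₁.map (f ⊗ₘ g)).hom (mul₁₀ V W c x) = mul₁₀ V' W' ((F₁.map f).hom c) ((F₀.map g).hom x)
  assoc₀₀₁ : ∀ (U V W : FGProj R) (x : F₀.obj U) (y : F₀.obj V) (c : F₁.obj W),
    (F₁.map (α_ U V W).hom).hom (mul₀₁ (U ⊗ V) W (mul U V x y) c) =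
      mul₀₁ U (V ⊗ W) x (mul₀₁ V W y c)
  assoc₀₁₀ : ∀ (U V W : FGProj R) (x : F₀.obj U) (c : F₁.obj V) (y : F₀.obj W),
    (F₁.map (α_ U V W).hom).hom (mul₁₀ (U ⊗ V) W (mul₀₁ U V x c) y) =
      mul₀₁ U (V ⊗ W) x (mul₁₀ V W c y)
  assoc₁₀₀ : ∀ (U V W : FGProj R) (c : F₁.obj U) (x : F₀.obj V) (y : F₀.obj W),
    (F₁.map (α_ U V W).hom).hom (mul₁₀ (U ⊗ V) W (mul₁₀ U V c x) y) =
      mul₁₀ U (V ⊗ W) c (mul V W x y)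
  one_mul₀₁ : ∀ V (c : F₁.obj V), (F₁.map (λ_ V).hom).hom (mul₀₁ (𝟙_ _) V one c) = c
  mul₁₀_one : ∀ V (c : F₁.obj V), (F₁.map (ρ_ V).hom).hom (mul₁₀ V (𝟙_ _) c one) = c
  leibniz₀₁ : ∀ V W (x : F₀.obj V) (c : F₁.obj W),
    (d.app (V ⊗ W)).hom (mul₀₁ V W x c) = mul V W x ((d.app W).hom c)
  leibniz₁₀ : ∀ V W (c : F₁.obj V) (x : F₀.obj W),
    (d.app (V ⊗ W)).hom (mul₁₀ V W c x) = mul V W ((d.app V).hom c) x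
  leibniz₁₁ : ∀ V W (c : F₁.obj V) (c' : F₁.obj W),
    mul₀₁ V W ((d.app V).hom c) c' - mul₁₀ V W c ((d.app W).hom c') = 0

/-- A multiplicative structure on an elementary extension of an algebra `A`: a DG algebra structure
on the complex `d : C₁ ⟶ C₀` for which the augmentation `a` is a map of DG algebras (in positive
degrees, this is no condition). -/
structure ElemExt.Mul {A B : ProjFunctor R S} (φ : ElemExt A B) (α : FunctorMul A)
    extends ComplexMul φ.d where
  a_one : (φ.a.app (𝟙_ _)).hom one = α.one
  a_mul : ∀ V W (x : φ.C₀.obj V) (y : φ.C₀.obj W),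
    (φ.a.app (V ⊗ W)).hom (mul V W x y) = α.mul V W ((φ.a.app V).hom x) ((φ.a.app W).hom y)

/-- A multiplicative structure on a splitting `⟨X, c₀, c₁⟩` of a multiplicative elementary
extension: a DG algebra structure on the complex `c₁ : C₁ ⟶ X` for which the map of complexes with
components `id : C₁ ⟶ C₁` and `c₀ : X ⟶ C₀` is a map of DG algebras. -/
structure ElemExt.Splitting.Mul {A B : ProjFunctor R S} {φ : ElemExt A B} {α : FunctorMul A}
    (X : φ.Splitting) (μ : φ.Mul α) extends ComplexMul X.c₁ where
  c₀_one : (X.c₀.app (𝟙_ _)).hom one = μ.one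
  c₀_mul : ∀ V W (x : X.X.obj V) (y : X.X.obj W),
    (X.c₀.app (V ⊗ W)).hom (mul V W x y) = μ.mul V W ((X.c₀.app V).hom x) ((X.c₀.app W).hom y)
  id_mul₀₁ : ∀ V W (x : X.X.obj V) (c : φ.C₁.obj W),
    mul₀₁ V W x c = μ.mul₀₁ V W ((X.c₀.app V).hom x) c
  id_mul₁₀ : ∀ V W (c : φ.C₁.obj V) (x : X.X.obj W),
    mul₁₀ V W c x = μ.mul₁₀ V W c ((X.c₀.app W).hom x)

variable {S' : Type*} [Ring S']

/-- Restriction of scalars of a multiplicative structure: the products are the same. -/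
def FunctorMul.restrict (f : S' →+* S) {F : ProjFunctor R S} (μ : FunctorMul F) :
    FunctorMul (restr f F) where
  one := μ.one
  mul := μ.mul
  smul_mul := fun V W s x y => μ.smul_mul V W (f s) x y
  mul_smul := fun V W s x y => μ.mul_smul V W (f s) x y
  map_mul := μ.map_mul
  assoc := μ.assoc
  one_mul := μ.one_mul
  mul_one := μ.mul_one

/-- Restriction of scalars of a multiplicative structure: the products are the same. -/
def ComplexMul.restrict (f : S' →+* S) {F₁ F₀ : ProjFunctor R S} {d : F₁ ⟶ F₀}
    (μ : ComplexMul d) : ComplexMul (restrMap f d) where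
  toFunctorMul := μ.toFunctorMul.restrict f
  mul₀₁ := μ.mul₀₁
  mul₁₀ := μ.mul₁₀
  smul_mul₀₁ := fun V W s x c => μ.smul_mul₀₁ V W (f s) x c
  mul₀₁_smul := fun V W s x c => μ.mul₀₁_smul V W (f s) x c
  smul_mul₁₀ := fun V W s c x => μ.smul_mul₁₀ V W (f s) c x
  mul₁₀_smul := fun V W s c x => μ.mul₁₀_smul V W (f s) c x
  map_mul₀₁ := μ.map_mul₀₁
  map_mul₁₀ := μ.map_mul₁₀
  assoc₀₀₁ := μ.assoc₀₀₁
  assoc₀₁₀ := μ.assoc₀₁₀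
  assoc₁₀₀ := μ.assoc₁₀₀
  one_mul₀₁ := μ.one_mul₀₁
  mul₁₀_one := μ.mul₁₀_one
  leibniz₀₁ := μ.leibniz₀₁
  leibniz₁₀ := μ.leibniz₁₀
  leibniz₁₁ := μ.leibniz₁₁

/-- Restriction of scalars of a multiplicative elementary extension. -/
def ElemExt.Mul.restrict (f : S' →+* S) {A B : ProjFunctor R S} {φ : ElemExt A B}
    {α : FunctorMul A} (μ : φ.Mul α) : (φ.restrict f).Mul (α.restrict f) where
  toComplexMul := μ.toComplexMul.restrict f
  a_one := μ.a_one
  a_mul := μ.a_mul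

variable (R) in
/-- The multiplicative structure of the tautological functor `I`: `(v, w) ↦ v ⊗ w`, with the unit
`1 ∈ R`. -/
def tautMul : FunctorMul (tautFunctor R) where
  one := (1 : R)
  mul := fun V W => AddMonoidHom.mk' (fun x => (TensorProduct.mk R V.obj W.obj x).toAddMonoidHom)
    (fun x x' => by ext y; exact TensorProduct.add_tmul x x' y)
  smul_mul := fun V W s x y => (TensorProduct.smul_tmul' s x y).symm
  mul_smul := fun V W s x y => TensorProduct.tmul_smul s x y
  map_mul := fun f g x y => rfl
  assoc := fun U V W x y z => rfl
  one_mul := fun V x => one_smul R (x : V.obj)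
  mul_one := fun V x => one_smul R (x : V.obj)

end Multiplicative

/-! ### Square-zero extensions -/

section SquareZero

variable {R : Type u} [CommRing R] {M : Type u} [AddCommGroup M] [Module R M] [Module Rᵐᵒᵖ M]

/-- The ring `R'` with the maps `i : M → R'` and `q : R' → R` is a square-zero extension of `R`
by the `R`-bimodule `M`. -/
structure IsSquareZeroExtension {R' : Type*} [Ring R'] (i : M →+ R') (q : R' →+* R) : Prop where
  injective : Function.Injective i
  exact : Function.Exact i q
  surjective : Function.Surjective q
  right : ∀ (m : M) (r' : R'), i m * r' = i (op (q r') • m)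
  left : ∀ (m : M) (r' : R'), r' * i m = i (q r' • m)
  square_zero : ∀ m m' : M, i m * i m' = 0

variable [SMulCommClass R Rᵐᵒᵖ M]

/-- An elementary extension of a commutative ring `R` by an `R`-bimodule `M` is an elementary
extension of `I` by `I(M)` in `B(R) = B(R, R)`. -/
abbrev RingElemExt (R : Type u) [CommRing R] (M : Type u) [AddCommGroup M] [Module R M]
    [Module Rᵐᵒᵖ M] [SMulCommClass R Rᵐᵒᵖ M] :=
  ElemExt (tautFunctor R) (bimodFunctor R M)

namespace RingElemExt

/-- The elementary extension `e_* φ` in `B(R, ℤ)`, where `e : ℤ → R` is the tautological map. -/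
abbrev eStar (φ : RingElemExt R M) := ElemExt.restrict (Int.castRingHom R) φ

variable {φ : RingElemExt R M} (X : (eStar φ).Splitting)

/-- The map `c₁ : C₁(V) → X(V)` of abelian groups. -/
def incl (V : FGProj R) : φ.C₁.obj V →+ X.X.obj V := (X.c₁.app V).hom.toAddMonoidHom

/-- The map `c₀ : X(V) → C₀(V)` of abelian groups. -/
def proj (V : FGProj R) : X.X.obj V →+ φ.C₀.obj V := (X.c₀.app V).hom.toAddMonoidHom

/-- The action of an endomorphism of `X` on `X(V)`; multiplication in `End X.X` is composition of
maps, `f * g = f ∘ g`. -/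
def act (f : End X.X) (V : FGProj R) : X.X.obj V →+ X.X.obj V :=
  (NatTrans.app (F := X.X) (G := X.X) f V).hom.toAddMonoidHom

theorem act_one (V : FGProj R) (x : X.X.obj V) : act X 1 V x = x := rfl

theorem act_mul (f g : End X.X) (V : FGProj R) (x : X.X.obj V) :
    act X (f * g) V x = act X f V (act X g V x) := rfl

theorem act_add (f g : End X.X) (V : FGProj R) (x : X.X.obj V) :
    act X (f + g) V x = act X f V x + act X g V x := rfl

theorem act_zero (V : FGProj R) (x : X.X.obj V) : act X 0 V x = 0 := rfl

theorem act_neg (f : End X.X) (V : FGProj R) (x : X.X.obj V) :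
    act X (-f) V x = -act X f V x := rfl

theorem act_ext {f g : End X.X} (h : ∀ V x, act X f V x = act X g V x) : f = g :=
  NatTrans.ext (funext fun V => ModuleCat.hom_ext (LinearMap.ext fun x => h V x))

/-- The endomorphism `f` of the splitting `X` of `e_* φ` is compatible, via `c₁` and `c₀`, with
multiplication by `r` on `C₁` and `C₀`. -/
def RegularOver (f : End X.X) (r : R) : Prop :=
  (∀ (V : FGProj R) (c : φ.C₁.obj V), act X f V (incl X V c) = incl X V (r • c)) ∧
  (∀ (V : FGProj R) (x : X.X.obj V), proj X V (act X f V x) = r • proj X V x)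

variable {X}

theorem RegularOver.one : RegularOver X 1 1 :=
  ⟨fun V c => by rw [one_smul, act_one], fun V x => by rw [one_smul, act_one]⟩

theorem RegularOver.zero : RegularOver X 0 0 :=
  ⟨fun V c => by rw [zero_smul, act_zero, map_zero],
    fun V x => by rw [zero_smul, act_zero, map_zero]⟩

theorem RegularOver.mul {f g : End X.X} {r s : R} (h : RegularOver X f r)
    (k : RegularOver X g s) : RegularOver X (f * g) (r * s) :=
  ⟨fun V c => by rw [act_mul, k.1, h.1, mul_smul], fun V x => by rw [act_mul, h.2, k.2, mul_smul]⟩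

theorem RegularOver.add {f g : End X.X} {r s : R} (h : RegularOver X f r)
    (k : RegularOver X g s) : RegularOver X (f + g) (r + s) :=
  ⟨fun V c => by rw [act_add, k.1, h.1, add_smul, map_add],
    fun V x => by rw [act_add, map_add, h.2, k.2, add_smul]⟩

theorem RegularOver.neg {f : End X.X} {r : R} (h : RegularOver X f r) : RegularOver X (-f) (-r) :=
  ⟨fun V c => by rw [act_neg, h.1, neg_smul, map_neg],
    fun V x => by rw [act_neg, map_neg, h.2, neg_smul]⟩

theorem RegularOver.unique {f : End X.X} {r s : R} (h : RegularOver X f r)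
    (k : RegularOver X f s) : r = s := by
  obtain ⟨y, hy⟩ := φ.a_surjective (𝟙_ _) (1 : R)
  obtain ⟨x, hx⟩ := X.c₀_surjective (𝟙_ _) y
  have hx' : proj X (𝟙_ _) x = y := hx
  have e := (h.2 _ x).symm.trans (k.2 _ x)
  rw [hx'] at e
  have e' := congrArg (φ.a.app (𝟙_ _)).hom e
  rw [map_smul, map_smul, hy] at e'
  simpa using (show r * 1 = s * 1 from e')

variable (X)

/-- The ring `R'` of regular endomorphisms of the splitting `X` of `e_* φ`. -/
def regularRing : Subring (End X.X) where
  carrier := {f | ∃ r : R, RegularOver X f r}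
  mul_mem' := fun ⟨_, h⟩ ⟨_, k⟩ => ⟨_, h.mul k⟩
  one_mem' := ⟨1, .one⟩
  add_mem' := fun ⟨_, h⟩ ⟨_, k⟩ => ⟨_, h.add k⟩
  zero_mem' := ⟨0, .zero⟩
  neg_mem' := fun ⟨_, h⟩ => ⟨_, h.neg⟩

/-- The map `q : R' → R` sending a regular endomorphism to the unique element `r ∈ R` over which it
is regular. -/
def regularProj : regularRing X →+* R where
  toFun f := f.2.choose
  map_one' := (1 : regularRing X).2.choose_spec.unique .one
  map_mul' f g := (f * g).2.choose_spec.unique (f.2.choose_spec.mul g.2.choose_spec)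
  map_zero' := (0 : regularRing X).2.choose_spec.unique .zero
  map_add' f g := (f + g).2.choose_spec.unique (f.2.choose_spec.add g.2.choose_spec)

theorem regularProj_spec (f : regularRing X) : RegularOver X f.1 (regularProj X f) :=
  f.2.choose_spec

/-- A map of abelian groups, as a morphism of `ℤ`-modules. -/
def intHom {N N' : ModuleCat.{u} ℤ} (f : N →+ N') : N ⟶ N' :=
  ModuleCat.ofHom
    { toFun := f
      map_add' := map_add f
      map_smul' := fun n x => by simpa using map_intCast_smul f ℤ ℤ n x }

/-- The natural transformation `V → M ⊗_R V`, `v ↦ m ⊗ v`, of functors to abelian groups. -/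
def tmulLeft (m : M) : restr (Int.castRingHom R) (tautFunctor R) ⟶
    restr (Int.castRingHom R) (bimodFunctor R M) where
  app V := intHom (N := (restr (Int.castRingHom R) (tautFunctor R)).obj V)
    (N' := (restr (Int.castRingHom R) (bimodFunctor R M)).obj V) (bimodMk m V)
  naturality _ _ _ := rfl

/-- The endomorphism of `X` given by the composition of
`X → C₀ → I`, of `v ↦ m ⊗ v`, and of `I(M) → C₁ → X`. -/
def kernelEnd (m : M) : End X.X :=
  X.c₀ ≫ (eStar φ).a ≫ tmulLeft m ≫ (eStar φ).b ≫ X.c₁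

theorem act_kernelEnd (m : M) (V : FGProj R) (x : X.X.obj V) :
    act X (kernelEnd X m) V x =
      incl X V ((φ.b.app V).hom (bimodMk m V ((φ.a.app V).hom (proj X V x)))) := rfl

theorem proj_incl (V : FGProj R) (c : φ.C₁.obj V) :
    proj X V (incl X V c) = (φ.d.app V).hom c :=
  congrArg (fun t : φ.eStar.C₁ ⟶ φ.eStar.C₀ => (t.app V).hom.toAddMonoidHom c) X.comp

theorem kernelEnd_regular (m : M) : RegularOver X (kernelEnd X m) 0 := by
  refine ⟨fun V c => ?_, fun V x => ?_⟩
  · have h : (φ.a.app V).hom ((φ.d.app V).hom c) = (0 : V.obj) := (φ.exact₀ V).apply_apply_eq_zero c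
    rw [act_kernelEnd, proj_incl, zero_smul, map_zero, h, map_zero, map_zero, map_zero]
  · rw [act_kernelEnd, proj_incl, (φ.exact₁ V).apply_apply_eq_zero, zero_smul]

theorem bimodMk_add (m m' : M) (V : FGProj R) (v : V.obj) :
    bimodMk (m + m') V v = bimodMk m V v + bimodMk m' V v :=
  TensorProduct.add_tmul m m' _

/-- The map `i : M → R'`. -/
def regularIncl : M →+ regularRing X :=
  AddMonoidHom.mk' (fun m => ⟨kernelEnd X m, 0, kernelEnd_regular X m⟩) fun m m' => by
    refine Subtype.ext (act_ext X fun V x => ?_)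
    refine Eq.trans ?_ (act_add X (kernelEnd X m) (kernelEnd X m') V x).symm
    rw [act_kernelEnd, act_kernelEnd, act_kernelEnd, bimodMk_add, map_add, map_add]

/-- The tautological action of the ring `R'` of regular endomorphisms on `X(V)`. -/
abbrev regularModule (V : FGProj R) : Module (regularRing X) (X.X.obj V) where
  smul f x := act X f.1 V x
  one_smul _ := rfl
  mul_smul _ _ _ := rfl
  smul_zero f := map_zero (act X f.1 V)
  smul_add f := map_add (act X f.1 V)
  add_smul _ _ _ := rfl
  zero_smul _ := rfl

/-- The abelian group `X(V)` with the tautological action of `R'`. -/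
abbrev regularObj (V : FGProj R) : ModuleCat.{u} (regularRing X) :=
  letI := regularModule X V
  ModuleCat.of (regularRing X) (X.X.obj V)

theorem regularObj_smul (V : FGProj R) (f : regularRing X) (x : regularObj X V) :
    f • x = act X f.1 V x := rfl

/-- The functor `X`, considered as a functor to `R'`-modules by means of the tautological action. -/
def regularFunctor : ProjFunctor R (regularRing X) where
  obj V := regularObj X V
  map {V W} g := ModuleCat.ofHom (X := regularObj X V) (Y := regularObj X W)
    { toFun := (X.X.map g).hom
      map_add' := map_add (X.X.map g).hom
      map_smul' := fun f x =>
        (LinearMap.congr_fun (congrArg ModuleCat.Hom.hom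
          (NatTrans.naturality (F := X.X) (G := X.X) f.1 g)) x).symm }
  map_id V := ModuleCat.hom_ext (LinearMap.ext fun x =>
    LinearMap.congr_fun (congrArg ModuleCat.Hom.hom (X.X.map_id V)) x)
  map_comp f g := ModuleCat.hom_ext (LinearMap.ext fun x =>
    LinearMap.congr_fun (congrArg ModuleCat.Hom.hom (X.X.map_comp f g)) x)

/-- The splitting `X` of `e_* φ`, with the tautological action of `R'` on `X`, considered as a
splitting of the elementary extension `q_* φ` in `B(R, R')`. -/
def regularSplitting : (ElemExt.restrict (regularProj X) φ).Splitting where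
  X := regularFunctor X
  pointed := X.pointed
  c₁ :=
    { app := fun V =>
        ModuleCat.ofHom (X := (restr (regularProj X) φ.C₁).obj V) (Y := regularObj X V)
          { toFun := incl X V
            map_add' := map_add (incl X V)
            map_smul' := fun f c => ((regularProj_spec X f).1 V c).symm }
      naturality := fun _ _ g => ModuleCat.hom_ext (LinearMap.ext fun c =>
        LinearMap.congr_fun (congrArg ModuleCat.Hom.hom (X.c₁.naturality g)) c) }
  c₀ :=
    { app := fun V =>
        ModuleCat.ofHom (X := regularObj X V) (Y := (restr (regularProj X) φ.C₀).obj V)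
          { toFun := proj X V
            map_add' := map_add (proj X V)
            map_smul' := fun f x => (regularProj_spec X f).2 V x }
      naturality := fun _ _ g => ModuleCat.hom_ext (LinearMap.ext fun x =>
        LinearMap.congr_fun (congrArg ModuleCat.Hom.hom (X.c₀.naturality g)) x) }
  comp := NatTrans.ext (funext fun V => ModuleCat.hom_ext (LinearMap.ext fun c => proj_incl X V c))
  cartesian := X.cartesian
  c₀_surjective := X.c₀_surjective

end RingElemExt

end SquareZero

end

/-! Choose an element `u` of `X(R)` over `1 ∈ R`. By functoriality each `v ∈ V` gives `[v] = v_* u`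
in `X(V)`, a natural but non-additive section of `X → I`. The kernel of `X → I` is `C₁`, so every
element of `X(V)` is uniquely `[v] + c` with `c ∈ C₁(V)`. The only obstruction to a direct sum is
the natural symmetric cocycle `[v] + [v'] - [v + v']` with values in `C₁(V)`.

The main tool is a rigidity principle (`natural_eq_zero_of_single`): a natural map `V^n → I(M)(V)`
vanishing on tuples with at most one nonzero entry is zero. It is determined by its value on the
basis of `R^n`, and `I(M)` is additive. Hence identities between normalized natural cochains in `C₁`
hold as soon as they hold after applying `d`.

A splitting exists because the additivity defect of brackets in `C₀` lifts to `C₁`, and rigidity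
makes the normalized lift a symmetric cocycle (`exists_defect`); the corresponding twisted sum of
`V` and `C₁(V)` is the splitting. For `r ∈ R`, the formula `[v] + c ↦ v_* w + r c`, with `w` a lift
of `r c₀(u)`, defines an endomorphism over `r`; rigidity gives its additivity
(`exists_regularOver`). An endomorphism over `0` is determined by its value at `u`, which lies in
`I(M)(R) = M`.

If moreover `c₀(u)` is the unit of `C₀`, the rules `[v][w] = [v ⊗ w]`, `x c = c₀(x) c`, `c y = c
c₀(y)` define a product on `X`; the Leibniz rule in degree `(1,1)` makes it biadditive. For any
product on the splitting, regular endomorphisms can be moved out of either factor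
(`RegularOver.act_mul`, `RegularOver.mul_act`). This is bilinearity over `R'`, and an Eckmann–Hilton
argument turns it into commutativity of `R'`. -/

noncomputable section

/-! ### Elements and tuples of `V` as morphisms from free modules. -/

section

variable {R : Type u} [CommRing R] {S : Type w} [Ring S]

/-- The morphism of `R-proj` given by a linear map. -/
abbrev FGProj.ofLinear {V W : FGProj R} (f : V.obj →ₗ[R] W.obj) : V ⟶ W :=
  ObjectProperty.homMk (ModuleCat.ofHom f)

theorem FGProj.hom_ext' {V W : FGProj R} {f g : V ⟶ W}
    (h : ∀ v : V.obj, f.hom.hom v = g.hom.hom v) :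
    f = g :=
  ObjectProperty.hom_ext _ (ModuleCat.hom_ext (LinearMap.ext h))

/-- The map `R → V` sending `1` to `v`. -/
def FGProj.point {V : FGProj R} (v : V.obj) : 𝟙_ (FGProj R) ⟶ V :=
  FGProj.ofLinear (V := 𝟙_ (FGProj R)) (LinearMap.toSpanSingleton R V.obj v)

theorem FGProj.point_comp {V W : FGProj R} (v : V.obj) (f : V ⟶ W) :
    point v ≫ f = point (f.hom.hom v) := by
  refine hom_ext' fun (r : R) => ?_
  exact map_smul f.hom.hom r v

/-- The free module of rank `n` as an object of `R-proj`. -/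
def FGProj.free (R : Type u) [CommRing R] (n : ℕ) : FGProj R :=
  ⟨ModuleCat.of R (Fin n → R), inferInstanceAs (Module.Finite R (Fin n → R)),
    inferInstanceAs (Module.Projective R (Fin n → R))⟩

/-- The map `R^n → V` given by a tuple of elements of `V`. -/
def FGProj.tuple {V : FGProj R} {n : ℕ} (v : Fin n → V.obj) : free R n ⟶ V :=
  FGProj.ofLinear (V := free R n) (Fintype.linearCombination R v)

/-- The standard basis of `R^n`. -/
def FGProj.basisTuple (R : Type u) [CommRing R] (n : ℕ) (j : Fin n) : (free R n).obj :=
  (Pi.single j 1 : Fin n → R)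

theorem FGProj.tuple_basisTuple {V : FGProj R} {n : ℕ} (v : Fin n → V.obj) (j : Fin n) :
    (tuple v).hom.hom (basisTuple R n j) = v j := by
  exact (Fintype.linearCombination_apply_single R v j 1).trans (one_smul R _)

theorem FGProj.tuple_comp {V W : FGProj R} {n : ℕ} (v : Fin n → V.obj) (f : V ⟶ W) :
    tuple v ≫ f = tuple (fun j => f.hom.hom (v j)) := by
  refine hom_ext' fun (r : Fin n → R) => ?_
  change f.hom.hom (Fintype.linearCombination R v r) = Fintype.linearCombination R _ r
  simp [Fintype.linearCombination_apply]

end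

/-! ### Brackets, and natural maps with values in `I(M)`. -/

section

variable {R : Type u} [CommRing R] {S : Type w} [Ring S]

namespace ProjFunctor

variable (F : ProjFunctor R S)

theorem map_map_apply {U V W : FGProj R} (f : U ⟶ V) (g : V ⟶ W) (x : F.obj U) :
    (F.map g).hom ((F.map f).hom x) = (F.map (f ≫ g)).hom x := by
  rw [F.map_comp]; rfl

theorem map_id_apply {V : FGProj R} (x : F.obj V) : (F.map (𝟙 V)).hom x = x := by
  rw [F.map_id]; rfl

-- A zero map factors through `R^0`, where a pointed functor vanishes.
variable {F} in
theorem map_zero_apply (hF : IsPointed F) {V W : FGProj R} {f : V ⟶ W}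
    (hf : ∀ v : V.obj, f.hom.hom v = 0) (x : F.obj V) : (F.map f).hom x = 0 := by
  have hs : Subsingleton (FGProj.free R 0).obj := inferInstanceAs (Subsingleton (Fin 0 → R))
  have := hF _ hs
  have e : f = FGProj.ofLinear (W := FGProj.free R 0) 0 ≫
      FGProj.ofLinear (V := FGProj.free R 0) (W := W) 0 :=
    FGProj.hom_ext' fun v => hf v
  rw [e, ← map_map_apply, Subsingleton.elim ((F.map _).hom x) 0, map_zero]

/-- The element of `F(V)` induced by `t ∈ F(R)` and `v ∈ V`. -/
def bracket (t : F.obj (𝟙_ (FGProj R))) {V : FGProj R} (v : V.obj) : F.obj V :=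
  (F.map (FGProj.point v)).hom t

theorem map_bracket (t : F.obj (𝟙_ (FGProj R))) {V W : FGProj R} (f : V ⟶ W) (v : V.obj) :
    (F.map f).hom (F.bracket t v) = F.bracket t (f.hom.hom v) := by
  rw [bracket, bracket, map_map_apply, FGProj.point_comp]

variable {F} in
theorem bracket_zero (hF : IsPointed F) (t : F.obj (𝟙_ (FGProj R))) {V : FGProj R} :
    F.bracket t (0 : V.obj) = 0 :=
  map_zero_apply hF (fun r : R => smul_zero r) t

theorem bracket_one (t : F.obj (𝟙_ (FGProj R))) :
    F.bracket t (V := 𝟙_ (FGProj R)) (1 : R) = t := by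
  have e : FGProj.point (V := 𝟙_ (FGProj R)) (1 : R) = 𝟙 _ :=
    FGProj.hom_ext' fun r : R => mul_one r
  rw [bracket, e, map_id_apply]

end ProjFunctor

section CrossEffect

variable {M : Type u} [AddCommGroup M] [Module R M] [Module Rᵐᵒᵖ M] [SMulCommClass R Rᵐᵒᵖ M]

theorem bimodFunctor_map_tmul {V W : FGProj R} (f : V ⟶ W) (m : M) (v : V.obj) :
    ((bimodFunctor R M).map f).hom (bimodMk m V v) = bimodMk m W (f.hom.hom v) := rfl

theorem bimodTensor_induction {V : FGProj R} {p : (bimodFunctor R M).obj V → Prop}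
    (x : (bimodFunctor R M).obj V) (h0 : p 0)
    (h : ∀ m v, p (bimodMk m V v)) (hadd : ∀ x y, p x → p y → p (x + y)) : p x :=
  TensorProduct.induction_on (motive := p) x h0 h hadd

/-- The functor `I(M)` is additive: an element of `M ⊗ R^n` is the sum of its components. -/
theorem bimodFunctor_sum_components {n : ℕ} (x : (bimodFunctor R M).obj (FGProj.free R n)) :
    ∑ j : Fin n, ((bimodFunctor R M).map (FGProj.ofLinear (V := FGProj.free R n)
      (W := FGProj.free R n) (LinearMap.single R (fun _ => R) j ∘ₗ LinearMap.proj j))).hom x = x := by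
  induction x using bimodTensor_induction with
  | h0 => simp
  | hadd x y hx hy => simp only [map_add, Finset.sum_add_distrib, hx, hy]
  | h m v =>
    simp only [bimodFunctor_map_tmul]
    rw [← map_sum]
    congr 1
    exact LinearMap.sum_single_apply (fun _ : Fin n => R) v

/-- A natural map `V^n → G(V)` which takes values in the image of an additive functor `I(M)` and
vanishes on tuples with a single nonzero entry is zero. -/
theorem natural_eq_zero_of_single {G : ProjFunctor R S}
    (β : ∀ V, (bimodFunctor R M).obj V →+ G.obj V)
    (hβ : ∀ {V W} (f : V ⟶ W) x, β W (((bimodFunctor R M).map f).hom x) = (G.map f).hom (β V x))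
    {n : ℕ} (T : ∀ V : FGProj R, (Fin n → V.obj) → G.obj V)
    (hT : ∀ {V W : FGProj R} (f : V ⟶ W) v, (G.map f).hom (T V v) = T W fun j => f.hom.hom (v j))
    (hr : ∀ V v, ∃ x, β V x = T V v)
    (h0 : ∀ (V : FGProj R) (j : Fin n) (v : V.obj), T V (Pi.single j v) = 0)
    (V : FGProj R) (v : Fin n → V.obj) : T V v = 0 := by
  -- The standard basis of `R^n` is the universal tuple. The `j`-th component of its image is, by
  -- naturality, the value of `T` on the tuple whose only nonzero entry is the `j`-th basis vector.
  have key : T (FGProj.free R n) (FGProj.basisTuple R n) = 0 := by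
    obtain ⟨x, hx⟩ := hr _ (FGProj.basisTuple R n)
    rw [← hx, ← bimodFunctor_sum_components x, map_sum]
    refine Finset.sum_eq_zero fun j _ => ?_
    rw [hβ, hx, hT, ← h0 _ j (FGProj.basisTuple R n j)]
    congr 1
    funext i
    change (Pi.single j ((Pi.single i 1 : Fin n → R) j) : Fin n → R) = _
    rcases eq_or_ne i j with rfl | h
    · rw [Pi.single_eq_same]
      exact (Pi.single_eq_same (M := fun _ => (FGProj.free R n).obj) i _).symm
    · rw [Pi.single_eq_of_ne h, Pi.single_eq_of_ne (Ne.symm h), Pi.single_zero]; rfl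
  have := hT (FGProj.tuple v) (FGProj.basisTuple R n)
  simp only [key, map_zero, FGProj.tuple_basisTuple] at this
  exact this.symm

/-- The case of two variables yields the symmetry of the defect and the comparison of two defects;
the case of three variables yields the cocycle identity. -/
theorem natural₂_eq_zero {G : ProjFunctor R S}
    (β : ∀ V, (bimodFunctor R M).obj V →+ G.obj V)
    (hβ : ∀ {V W} (f : V ⟶ W) x, β W (((bimodFunctor R M).map f).hom x) = (G.map f).hom (β V x))
    (T : ∀ V : FGProj R, V.obj → V.obj → G.obj V)
    (hT : ∀ {V W : FGProj R} (f : V ⟶ W) v v',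
      (G.map f).hom (T V v v') = T W (f.hom.hom v) (f.hom.hom v'))
    (hr : ∀ V v v', ∃ x, β V x = T V v v')
    (h₀ : ∀ V v, T V v 0 = 0) (h₁ : ∀ V v, T V 0 v = 0)
    (V : FGProj R) (v v' : V.obj) : T V v v' = 0 := by
  refine natural_eq_zero_of_single β hβ (n := 2) (fun V v => T V (v 0) (v 1))
    (fun f v => hT f _ _) (fun V v => hr V _ _) (fun V j v => ?_) V ![v, v']
  fin_cases j
  · exact h₀ V v
  · exact h₁ V v

theorem natural₃_eq_zero {G : ProjFunctor R S}
    (β : ∀ V, (bimodFunctor R M).obj V →+ G.obj V)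
    (hβ : ∀ {V W} (f : V ⟶ W) x, β W (((bimodFunctor R M).map f).hom x) = (G.map f).hom (β V x))
    (T : ∀ V : FGProj R, V.obj → V.obj → V.obj → G.obj V)
    (hT : ∀ {V W : FGProj R} (f : V ⟶ W) v v' v'',
      (G.map f).hom (T V v v' v'') = T W (f.hom.hom v) (f.hom.hom v') (f.hom.hom v''))
    (hr : ∀ V v v' v'', ∃ x, β V x = T V v v' v'')
    (h₀ : ∀ V v, T V v 0 0 = 0) (h₁ : ∀ V v, T V 0 v 0 = 0) (h₂ : ∀ V v, T V 0 0 v = 0)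
    (V : FGProj R) (v v' v'' : V.obj) : T V v v' v'' = 0 := by
  refine natural_eq_zero_of_single β hβ (n := 3) (fun V v => T V (v 0) (v 1) (v 2))
    (fun f v => hT f _ _ _) (fun V v => hr V _ _ _) (fun V j v => ?_) V ![v, v', v'']
  fin_cases j
  · exact h₀ V v
  · exact h₁ V v
  · exact h₂ V v

end CrossEffect

end

section

/-! ### Abelian extensions from symmetric cocycles. -/

section TwistedSum

/-- A normalized symmetric 2-cocycle on an abelian group `A` with values in `B`. -/
structure SymmCocycle (A B : Type*) [AddCommGroup A] [AddCommGroup B] where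
  toFun : A → A → B
  zero_right : ∀ x, toFun x 0 = 0
  symm : ∀ x y, toFun x y = toFun y x
  cocycle : ∀ x y z, toFun x y + toFun (x + y) z = toFun y z + toFun x (y + z)

/-- The extension of `A` by `B` defined by a symmetric cocycle. -/
@[ext]
structure TwistedSum {A B : Type*} [AddCommGroup A] [AddCommGroup B] (γ : SymmCocycle A B) where
  fst : A
  snd : B

variable {A B : Type*} [AddCommGroup A] [AddCommGroup B] (γ : SymmCocycle A B)

namespace TwistedSum

instance : Add (TwistedSum γ) :=
  ⟨fun x y => ⟨x.fst + y.fst, x.snd + y.snd - γ.toFun x.fst y.fst⟩⟩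

instance : Zero (TwistedSum γ) := ⟨⟨0, 0⟩⟩

instance : Neg (TwistedSum γ) := ⟨fun x => ⟨-x.fst, -x.snd + γ.toFun x.fst (-x.fst)⟩⟩

variable {γ}

@[simp] theorem fst_add (x y : TwistedSum γ) : (x + y).fst = x.fst + y.fst := rfl

@[simp] theorem snd_add (x y : TwistedSum γ) :
    (x + y).snd = x.snd + y.snd - γ.toFun x.fst y.fst := rfl

@[simp] theorem fst_zero : (0 : TwistedSum γ).fst = 0 := rfl

@[simp] theorem snd_zero : (0 : TwistedSum γ).snd = 0 := rfl

@[simp] theorem fst_neg (x : TwistedSum γ) : (-x).fst = -x.fst := rfl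

@[simp] theorem snd_neg (x : TwistedSum γ) : (-x).snd = -x.snd + γ.toFun x.fst (-x.fst) := rfl

theorem add_comm' (x y : TwistedSum γ) : x + y = y + x := by
  ext
  · exact add_comm _ _
  · simp [γ.symm x.fst y.fst, add_comm]

theorem add_zero' (x : TwistedSum γ) : x + 0 = x := by
  ext <;> simp [γ.zero_right]

instance : AddCommGroup (TwistedSum γ) where
  add_assoc x y z := by
    ext
    · exact add_assoc _ _ _
    · have := γ.cocycle x.fst y.fst z.fst
      simp only [snd_add, fst_add]
      rw [eq_sub_of_add_eq this]
      abel
  zero_add x := by rw [add_comm', add_zero']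
  add_zero := add_zero'
  add_comm := add_comm'
  neg_add_cancel x := by
    rw [add_comm']
    ext <;> simp
  nsmul := nsmulRec
  zsmul := zsmulRec

end TwistedSum

end TwistedSum

variable {R : Type u} [CommRing R] {M : Type u} [AddCommGroup M] [Module R M] [Module Rᵐᵒᵖ M]
  [SMulCommClass R Rᵐᵒᵖ M]

/-! ### Existence of a splitting over the integers. -/

namespace RingElemExt

variable (φ : RingElemExt R M)

theorem b_naturality {V W : FGProj R} (f : V ⟶ W) (x : (bimodFunctor R M).obj V) :
    (φ.b.app W).hom (((bimodFunctor R M).map f).hom x) = (φ.C₁.map f).hom ((φ.b.app V).hom x) :=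
  LinearMap.congr_fun (congrArg ModuleCat.Hom.hom (φ.b.naturality f)) x

theorem d_naturality {V W : FGProj R} (f : V ⟶ W) (c : φ.C₁.obj V) :
    (φ.d.app W).hom ((φ.C₁.map f).hom c) = (φ.C₀.map f).hom ((φ.d.app V).hom c) :=
  LinearMap.congr_fun (congrArg ModuleCat.Hom.hom (φ.d.naturality f)) c

theorem a_naturality {V W : FGProj R} (f : V ⟶ W) (x : φ.C₀.obj V) :
    (φ.a.app W).hom ((φ.C₀.map f).hom x) = f.hom.hom ((φ.a.app V).hom x) :=
  LinearMap.congr_fun (congrArg ModuleCat.Hom.hom (φ.a.naturality f)) x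

variable {φ} in
theorem a_bracket {o : φ.C₀.obj (𝟙_ (FGProj R))} (ho : (φ.a.app (𝟙_ _)).hom o = (1 : R))
    {V : FGProj R} (v : V.obj) : (φ.a.app V).hom (φ.C₀.bracket o v) = v := by
  rw [ProjFunctor.bracket, a_naturality, ho]
  exact one_smul R v

/-- The map `b`, as a family of maps of abelian groups. -/
def bHom (V : FGProj R) : (bimodFunctor R M).obj V →+ φ.C₁.obj V := (φ.b.app V).hom.toAddMonoidHom

theorem exists_bHom_of_d_eq_zero {V : FGProj R} {c : φ.C₁.obj V} (hc : (φ.d.app V).hom c = 0) :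
    ∃ x, φ.bHom V x = c :=
  (φ.exact₁ V c).1 hc

/-- The additivity defect of `v ↦ [v]` lifts naturally to `C₁`. -/
theorem exists_defect {o : φ.C₀.obj (𝟙_ (FGProj R))} (ho : (φ.a.app (𝟙_ _)).hom o = (1 : R)) :
    ∃ γ : ∀ V : FGProj R, SymmCocycle V.obj (φ.C₁.obj V),
      (∀ (V W : FGProj R) (f : V ⟶ W) v w,
        (φ.C₁.map f).hom ((γ V).toFun v w) = (γ W).toFun (f.hom.hom v) (f.hom.hom w)) ∧
      ∀ (V : FGProj R) v w, (φ.d.app V).hom ((γ V).toFun v w) =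
        φ.C₀.bracket o (v + w) - φ.C₀.bracket o v - φ.C₀.bracket o w := by
  let e := FGProj.basisTuple R 2
  -- The defect of the universal pair in `R^2` is killed by `a`. A single lift of it to `C₁(R^2)`,
  -- transported along all maps `R^2 → V`, gives lifts that are natural in `V`.
  obtain ⟨c, hc⟩ := (φ.exact₀ _ (φ.C₀.bracket o (e 0 + e 1) - φ.C₀.bracket o (e 0) -
    φ.C₀.bracket o (e 1))).1 (by
      rw [map_sub, map_sub, a_bracket ho, a_bracket ho, a_bracket ho]
      change e 0 + e 1 - e 0 - e 1 = (0 : (FGProj.free R 2).obj)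
      abel)
  let T (V : FGProj R) (v w : V.obj) : φ.C₁.obj V := (φ.C₁.map (FGProj.tuple ![v, w])).hom c
  have hT {V W : FGProj R} (f : V ⟶ W) v w :
      (φ.C₁.map f).hom (T V v w) = T W (f.hom.hom v) (f.hom.hom w) := by
    simp only [T, ProjFunctor.map_map_apply, FGProj.tuple_comp]
    congr 4
    funext j
    fin_cases j <;> rfl
  have hT0 (V : FGProj R) : T V 0 0 = 0 := by
    refine ProjFunctor.map_zero_apply φ.pointed₁ (fun r : Fin 2 → R => ?_) c
    change Fintype.linearCombination R ![(0 : V.obj), 0] r = 0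
    simp [Fintype.linearCombination_apply]
  have hTd (V : FGProj R) (v w : V.obj) : (φ.d.app V).hom (T V v w) =
      φ.C₀.bracket o (v + w) - φ.C₀.bracket o v - φ.C₀.bracket o w := by
    simp only [T, d_naturality, hc, map_sub, ProjFunctor.map_bracket, map_add, e,
      FGProj.tuple_basisTuple]
    rfl
  -- Removing the values on the two axes normalizes the lift. Its image under `d` is unchanged,
  -- since `[0] = 0`.
  let γ (V : FGProj R) (v w : V.obj) : φ.C₁.obj V := T V v w - T V v 0 - T V 0 w
  have hγ {V W : FGProj R} (f : V ⟶ W) v w :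
      (φ.C₁.map f).hom (γ V v w) = γ W (f.hom.hom v) (f.hom.hom w) := by
    simp only [γ, map_sub, hT, map_zero]
  have hγd (V : FGProj R) (v w : V.obj) : (φ.d.app V).hom (γ V v w) =
      φ.C₀.bracket o (v + w) - φ.C₀.bracket o v - φ.C₀.bracket o w := by
    simp only [γ, map_sub, hTd, add_zero, zero_add, ProjFunctor.bracket_zero φ.pointed₀]
    abel
  have hγr (V : FGProj R) (v : V.obj) : γ V v 0 = 0 := by simp [γ, hT0]
  have hγl (V : FGProj R) (v : V.obj) : γ V 0 v = 0 := by simp [γ, hT0]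
  -- Symmetry and the cocycle identity hold after `d`, so the discrepancies lie in `I(M)`; they
  -- vanish when at most one variable is nonzero, and rigidity applies.
  refine ⟨fun V => ⟨γ V, hγr V, fun v w => ?_, fun v w z => ?_⟩, fun V W f => hγ f, hγd⟩
  · refine sub_eq_zero.1 (natural₂_eq_zero φ.bHom φ.b_naturality
      (fun V v w => γ V v w - γ V w v) (fun f v w => ?_)
      (fun V v w => φ.exists_bHom_of_d_eq_zero ?_) (fun V v => ?_) (fun V v => ?_) V v w)
    · rw [map_sub, hγ, hγ]
    · rw [map_sub, hγd, hγd, add_comm v w]; abel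
    · rw [hγr, hγl, sub_zero]
    · rw [hγr, hγl, sub_zero]
  · refine sub_eq_zero.1 (natural₃_eq_zero φ.bHom φ.b_naturality
      (fun V v w z => γ V v w + γ V (v + w) z - (γ V w z + γ V v (w + z)))
      (fun f v w z => ?_) (fun V v w z => φ.exists_bHom_of_d_eq_zero ?_)
      (fun V v => ?_) (fun V v => ?_) (fun V v => ?_) V v w z)
    · simp only [map_sub, map_add, hγ]
    · simp only [map_sub, map_add, hγd, add_assoc v w z]; abel
    · simp [hγr]
    · simp [hγr, hγl]
    · simp [hγl]

/-- The splitting of `e_* φ` given by the twisted sums of `V` and `C₁(V)`. -/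
theorem nonempty_splitting {o : φ.C₀.obj (𝟙_ (FGProj R))}
    (ho : (φ.a.app (𝟙_ _)).hom o = (1 : R)) : Nonempty φ.eStar.Splitting := by
  obtain ⟨γ, hγ, hγd⟩ := φ.exists_defect ho
  have hd (V : FGProj R) (c : φ.C₁.obj V) :
      (φ.a.app V).hom ((φ.d.app V).hom c) = (0 : V.obj) := (φ.exact₀ V).apply_apply_eq_zero c
  let X (V : FGProj R) : ModuleCat.{u} ℤ := ModuleCat.of ℤ (TwistedSum (γ V))
  let mapX {V W : FGProj R} (f : V ⟶ W) : TwistedSum (γ V) →+ TwistedSum (γ W) := AddMonoidHom.mk'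
    (fun x : TwistedSum (γ V) =>
      (⟨f.hom.hom x.fst, (φ.C₁.map f).hom x.snd⟩ : TwistedSum (γ W)))
    (fun x y => TwistedSum.ext (map_add f.hom.hom x.fst y.fst)
      (by simp only [TwistedSum.snd_add, map_sub, map_add, hγ]))
  let F : ProjFunctor R ℤ :=
    { obj := X
      map := fun {V W} f => intHom (N := X V) (N' := X W) (mapX f)
      map_id := fun V => ModuleCat.hom_ext (LinearMap.ext fun x : TwistedSum (γ V) =>
        TwistedSum.ext rfl (ProjFunctor.map_id_apply φ.C₁ x.snd))
      map_comp := fun f g => ModuleCat.hom_ext (LinearMap.ext fun x =>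
        TwistedSum.ext rfl (ProjFunctor.map_map_apply φ.C₁ f g x.snd).symm) }
  -- Additivity uses the normalization `γ(0, 0) = 0`.
  let inc (V : FGProj R) : φ.C₁.obj V →+ TwistedSum (γ V) := AddMonoidHom.mk'
    (fun c => (⟨0, c⟩ : TwistedSum (γ V)))
    (fun c c' => TwistedSum.ext (add_zero (0 : V.obj)).symm
      (by simp only [TwistedSum.snd_add, (γ V).zero_right, sub_zero]))
  -- The minus sign in the addition of `TwistedSum` is the one matching `d γ(v, w) = [v + w] - [v] -
  -- [w]`.
  let prj (V : FGProj R) : TwistedSum (γ V) →+ φ.C₀.obj V := AddMonoidHom.mk'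
    (fun x : TwistedSum (γ V) => φ.C₀.bracket o x.fst + (φ.d.app V).hom x.snd)
    (fun x y => by
      simp only [TwistedSum.snd_add, TwistedSum.fst_add, map_sub, map_add, hγd]
      abel)
  refine ⟨{
    X := F
    pointed := fun V hV => ?_
    c₁ := {
      app := fun V => intHom (N := φ.eStar.C₁.obj V) (N' := X V) (inc V)
      naturality := fun V W f => ModuleCat.hom_ext (LinearMap.ext fun c =>
        TwistedSum.ext (map_zero f.hom.hom).symm rfl) }
    c₀ := {
      app := fun V => intHom (N := X V) (N' := φ.eStar.C₀.obj V) (prj V)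
      naturality := fun V W f => ModuleCat.hom_ext (LinearMap.ext fun x => ?_) }
    comp := NatTrans.ext (funext fun V => ModuleCat.hom_ext (LinearMap.ext fun c => ?_))
    cartesian := fun V x => ?_
    c₀_surjective := fun V x => ?_ }⟩
  · have := φ.pointed₁ V hV
    exact ⟨fun x y : TwistedSum (γ V) =>
      TwistedSum.ext (Subsingleton.elim x.fst y.fst) (Subsingleton.elim x.snd y.snd)⟩
  · change φ.C₀.bracket o (f.hom.hom (TwistedSum.fst x)) +
      (φ.d.app W).hom ((φ.C₁.map f).hom (TwistedSum.snd x)) =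
      (φ.C₀.map f).hom (φ.C₀.bracket o (TwistedSum.fst x) + (φ.d.app V).hom (TwistedSum.snd x))
    rw [map_add, ProjFunctor.map_bracket, d_naturality]
  · change φ.C₀.bracket o (0 : V.obj) + (φ.d.app V).hom c = (φ.d.app V).hom c
    rw [ProjFunctor.bracket_zero φ.pointed₀, zero_add]
  · rintro ⟨(c : φ.C₁.obj V), hc⟩
    have hc' : (φ.d.app V).hom c =
      φ.C₀.bracket o (TwistedSum.fst x) + (φ.d.app V).hom (TwistedSum.snd x) := hc
    have h0 : TwistedSum.fst x = (0 : V.obj) := by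
      have := congrArg (φ.a.app V).hom hc'
      rw [map_add, hd, hd, a_bracket ho, add_zero] at this
      exact this.symm
    exact ⟨TwistedSum.snd x, TwistedSum.ext h0.symm rfl, fun c h => congrArg TwistedSum.snd h⟩
  · revert x
    intro (x : φ.C₀.obj V)
    obtain ⟨c, hc⟩ := (φ.exact₀ V (x - φ.C₀.bracket o ((φ.a.app V).hom x : V.obj))).1 (by
      rw [map_sub, a_bracket ho, sub_self])
    refine ⟨(⟨(φ.a.app V).hom x, c⟩ : TwistedSum (γ V)), ?_⟩
    change φ.C₀.bracket o ((φ.a.app V).hom x : V.obj) + (φ.d.app V).hom c = x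
    rw [hc, add_sub_cancel]

end RingElemExt

end

/-! ### The structure of an arbitrary splitting and the square-zero extension. -/

section

variable {R : Type u} [CommRing R] {M : Type u} [AddCommGroup M] [Module R M] [Module Rᵐᵒᵖ M]
  [SMulCommClass R Rᵐᵒᵖ M]

/-- The map `m ⊗ r ↦ m r` from `M ⊗_R R` to `M` is a left inverse. -/
theorem bimodMk_one_injective :
    Function.Injective fun m : M => bimodMk m (𝟙_ (FGProj R)) (1 : R) := fun m m' h => by
  let g (m : M) (r : R) : M := op r • m
  let t : M →ₗ[Rᵐᵒᵖ] opModule (𝟙_ (FGProj R)).obj →ₗ[Rᵐᵒᵖ] M :=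
    LinearMap.mk₂ Rᵐᵒᵖ g (fun m m' r => smul_add _ m m')
      (fun s m (r : R) => smul_comm (op r) s m) (fun m (r r' : R) => add_smul (op r) (op r') m)
      (fun s m (r : R) => (congrArg (fun r' : R => op r' • m) (mul_comm s.unop r)).trans
        (mul_smul s (op r) m))
  have := congrArg (TensorProduct.lift t) h
  exact (one_smul Rᵐᵒᵖ m).symm.trans (this.trans (one_smul Rᵐᵒᵖ m'))

namespace RingElemExt

variable {φ : RingElemExt R M} (X : φ.eStar.Splitting)

theorem map_incl {V W : FGProj R} (f : V ⟶ W) (c : φ.C₁.obj V) :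
    (X.X.map f).hom (incl X V c) = incl X W ((φ.C₁.map f).hom c) :=
  (LinearMap.congr_fun (congrArg ModuleCat.Hom.hom (X.c₁.naturality f)) c).symm

theorem proj_map {V W : FGProj R} (f : V ⟶ W) (x : X.X.obj V) :
    proj X W ((X.X.map f).hom x) = (φ.C₀.map f).hom (proj X V x) :=
  LinearMap.congr_fun (congrArg ModuleCat.Hom.hom (X.c₀.naturality f)) x

theorem act_map (g : End X.X) {V W : FGProj R} (f : V ⟶ W) (x : X.X.obj V) :
    act X g W ((X.X.map f).hom x) = (X.X.map f).hom (act X g V x) :=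
  LinearMap.congr_fun (congrArg ModuleCat.Hom.hom (NatTrans.naturality (F := X.X) (G := X.X) g f)) x

theorem a_d (V : FGProj R) (c : φ.C₁.obj V) :
    (φ.a.app V).hom ((φ.d.app V).hom c) = (0 : V.obj) :=
  (φ.exact₀ V).apply_apply_eq_zero c

theorem incl_injective (V : FGProj R) : Function.Injective (incl X V) := fun _ c' h =>
  (X.cartesian V (incl X V c') ⟨c', (proj_incl X V c').symm⟩).unique h rfl

/-- The composition `X → C₀ → I`. -/
def aug (V : FGProj R) : X.X.obj V →+ V.obj :=
  AddMonoidHom.comp (φ.a.app V).hom.toAddMonoidHom (proj X V)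

theorem aug_map {V W : FGProj R} (f : V ⟶ W) (x : X.X.obj V) :
    aug X W ((X.X.map f).hom x) = f.hom.hom (aug X V x) := by
  change (φ.a.app W).hom (proj X W _) = f.hom.hom ((φ.a.app V).hom (proj X V x))
  rw [proj_map, a_naturality]

theorem aug_incl (V : FGProj R) (c : φ.C₁.obj V) : aug X V (incl X V c) = 0 := by
  change (φ.a.app V).hom (proj X V (incl X V c)) = (0 : V.obj)
  rw [proj_incl, a_d]

/-- Since `Ker a = Im d`, the cartesian square identifies the kernel of `X → I` with `C₁`. -/
theorem exists_incl {V : FGProj R} {x : X.X.obj V} (hx : aug X V x = 0) :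
    ∃ c : φ.C₁.obj V, incl X V c = x :=
  (X.cartesian V x ((φ.exact₀ V _).1 hx)).exists

theorem proj_bracket (u : X.X.obj (𝟙_ (FGProj R))) {V : FGProj R} (v : V.obj) :
    proj X V (X.X.bracket u v) = φ.C₀.bracket (proj X _ u) v :=
  proj_map X _ u

theorem act_bracket (f : End X.X) (u : X.X.obj (𝟙_ (FGProj R))) {V : FGProj R} (v : V.obj) :
    act X f V (X.X.bracket u v) = X.X.bracket (act X f _ u) v :=
  act_map X f _ u

/-- The composition `I(M) → C₁ → X`. -/
def inclBimod (V : FGProj R) : (bimodFunctor R M).obj V →+ X.X.obj V :=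
  (incl X V).comp (φ.bHom V)

theorem inclBimod_map {V W : FGProj R} (f : V ⟶ W) (x : (bimodFunctor R M).obj V) :
    inclBimod X W (((bimodFunctor R M).map f).hom x) = (X.X.map f).hom (inclBimod X V x) := by
  change incl X W ((φ.b.app W).hom _) = (X.X.map f).hom (incl X V ((φ.b.app V).hom x))
  rw [map_incl, b_naturality]

/-- The kernel of `c₀` is `I(M)`; this is what makes rigidity applicable to natural maps into `X`.
-/
theorem exists_inclBimod {V : FGProj R} {x : X.X.obj V} (hx : proj X V x = 0) :
    ∃ y, inclBimod X V y = x := by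
  obtain ⟨c, rfl⟩ := exists_incl X (x := x) (by
    change (φ.a.app V).hom (proj X V x) = (0 : V.obj)
    rw [hx]; exact map_zero _)
  rw [proj_incl] at hx
  obtain ⟨y, rfl⟩ := φ.exists_bHom_of_d_eq_zero hx
  exact ⟨y, rfl⟩

theorem exists_proj_eq (y : φ.C₀.obj (𝟙_ (FGProj R))) : ∃ u, proj X (𝟙_ _) u = y :=
  X.c₀_surjective _ y

section Decomposition

variable {X} {u : X.X.obj (𝟙_ (FGProj R))} (hu : aug X (𝟙_ _) u = (1 : R))

include hu

theorem aug_bracket {V : FGProj R} (v : V.obj) : aug X V (X.X.bracket u v) = v :=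
  (proj_bracket X u v ▸ a_bracket hu v : (φ.a.app V).hom (proj X V (X.X.bracket u v)) = v)

theorem exists_decomposition {V : FGProj R} (x : X.X.obj V) :
    ∃ c, incl X V c = x - X.X.bracket u (aug X V x) :=
  exists_incl X (by rw [map_sub, aug_bracket hu, sub_self])

/-- Brackets and `C₁(V)` generate `X(V)`, so additive identities need only be checked on these two
kinds of elements. -/
theorem splitting_induction {V : FGProj R} {p : X.X.obj V → Prop} (x : X.X.obj V)
    (hb : ∀ v, p (X.X.bracket u v)) (hi : ∀ c : φ.C₁.obj V, p (incl X V c))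
    (hadd : ∀ x y, p x → p y → p (x + y)) : p x := by
  obtain ⟨c, hc⟩ := exists_decomposition hu x
  rw [← sub_add_cancel x (X.X.bracket u (aug X V x)), ← hc]
  exact hadd _ _ (hi c) (hb _)

/-- An endomorphism is natural, so its value at `u` determines its values at all brackets `v_* u`.
-/
theorem end_ext {f g : End X.X} (h : act X f _ u = act X g _ u)
    (hi : ∀ V (c : φ.C₁.obj V), act X f V (incl X V c) = act X g V (incl X V c)) : f = g :=
  act_ext X fun V x => splitting_induction hu (p := fun x => act X f V x = act X g V x) x
    (fun v => by rw [act_bracket, act_bracket, h]) (hi V)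
    fun x y hx hy => by rw [map_add, map_add, hx, hy]

/-- The component in `C₁(V)` of an element of `X(V)`, with respect to the element `u ∈ X(R)`. -/
def rem (V : FGProj R) (x : X.X.obj V) : φ.C₁.obj V :=
  (exists_decomposition hu x).choose

theorem incl_rem {V : FGProj R} (x : X.X.obj V) :
    incl X V (rem hu V x) = x - X.X.bracket u (aug X V x) :=
  (exists_decomposition hu x).choose_spec

theorem rem_incl {V : FGProj R} (c : φ.C₁.obj V) : rem hu V (incl X V c) = c :=
  incl_injective X V (by
    rw [incl_rem, aug_incl, ProjFunctor.bracket_zero X.pointed, sub_zero])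

theorem rem_bracket {V : FGProj R} (v : V.obj) : rem hu V (X.X.bracket u v) = 0 :=
  incl_injective X V (by rw [incl_rem, aug_bracket hu, sub_self, map_zero])

theorem map_rem {V W : FGProj R} (f : V ⟶ W) (x : X.X.obj V) :
    (φ.C₁.map f).hom (rem hu V x) = rem hu W ((X.X.map f).hom x) :=
  incl_injective X W (by
    rw [incl_rem, ← map_incl, incl_rem, map_sub, ProjFunctor.map_bracket, aug_map])

theorem d_rem {V : FGProj R} (x : X.X.obj V) :
    (φ.d.app V).hom (rem hu V x) = proj X V x - φ.C₀.bracket (proj X _ u) (aug X V x) := by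
  rw [← proj_incl, incl_rem, map_sub, proj_bracket]

/-- The additivity defect of `v ↦ [v]`, as an element of `C₁(V)`. -/
def defect (V : FGProj R) (v w : V.obj) : φ.C₁.obj V :=
  rem hu V (X.X.bracket u v + X.X.bracket u w)

theorem incl_defect {V : FGProj R} (v w : V.obj) : incl X V (defect hu V v w) =
    X.X.bracket u v + X.X.bracket u w - X.X.bracket u (v + w) := by
  rw [defect, incl_rem, map_add, aug_bracket hu, aug_bracket hu]

theorem map_defect {V W : FGProj R} (f : V ⟶ W) (v w : V.obj) :
    (φ.C₁.map f).hom (defect hu V v w) = defect hu W (f.hom.hom v) (f.hom.hom w) := by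
  rw [defect, map_rem, map_add, ProjFunctor.map_bracket, ProjFunctor.map_bracket]; rfl

theorem d_defect {V : FGProj R} (v w : V.obj) : (φ.d.app V).hom (defect hu V v w) =
    φ.C₀.bracket (proj X _ u) v + φ.C₀.bracket (proj X _ u) w -
      φ.C₀.bracket (proj X _ u) (v + w) := by
  rw [← proj_incl, incl_defect, map_sub, map_add, proj_bracket, proj_bracket, proj_bracket]

theorem rem_add {V : FGProj R} (x y : X.X.obj V) : rem hu V (x + y) =
    rem hu V x + rem hu V y + defect hu V (aug X V x) (aug X V y) :=
  incl_injective X V (by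
    rw [map_add, map_add, incl_rem, incl_rem, incl_rem, incl_defect, map_add]; abel)

/-- If `w ∈ X(R)` lies over `r • c₀(u)`, then the additivity defects of `v ↦ v_* w` and of
`v ↦ v_* u` differ by the factor `r`. -/
theorem bracket_defect_of_proj_eq_smul {w : X.X.obj (𝟙_ (FGProj R))} {r : R}
    (hw : proj X _ w = r • proj X _ u) {V : FGProj R} (v v' : V.obj) :
    X.X.bracket w v + X.X.bracket w v' - X.X.bracket w (v + v') =
      incl X V (r • defect hu V v v') := by
  have hpw {V : FGProj R} (v : V.obj) :
      proj X V (X.X.bracket w v) = r • φ.C₀.bracket (proj X _ u) v := by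
    rw [proj_bracket, hw, ProjFunctor.bracket, map_smul]; rfl
  have hd0 (V : FGProj R) (v : V.obj) : defect hu V v 0 = 0 ∧ defect hu V 0 v = 0 := by
    constructor <;> refine incl_injective X V ?_ <;>
      simp [incl_defect, ProjFunctor.bracket_zero X.pointed]
  -- Both sides have the same image in `C₀`, so their difference lies in `I(M)`; it vanishes when
  -- either variable is zero.
  refine sub_eq_zero.1 (natural₂_eq_zero (inclBimod X) (inclBimod_map X)
    (fun V v v' => X.X.bracket w v + X.X.bracket w v' - X.X.bracket w (v + v') -
      incl X V (r • defect hu V v v'))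
    (fun f v v' => ?_) (fun V v v' => exists_inclBimod X ?_) (fun V v => ?_) (fun V v => ?_) V v v')
  · simp only [map_sub, map_add, map_incl, map_smul, ProjFunctor.map_bracket, map_defect]
  · rw [map_sub, map_sub, map_add, hpw, hpw, hpw, proj_incl, map_smul, d_defect, smul_sub, smul_add,
      sub_self]
  · simp [hd0, ProjFunctor.bracket_zero X.pointed]
  · simp [hd0, ProjFunctor.bracket_zero X.pointed]

/-- Being `r` on `C₁` and lying over `r` on `C₀` forces `u` to go to a lift `w` of `r c₀(u)`, and
then `[v] + c` to `v_* w + r c`. Any such `w` works: its additivity defect is `r` times that of `u`,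
which is exactly additivity of this map. -/
theorem exists_regularOver (r : R) : ∃ f : End X.X, RegularOver X f r := by
  obtain ⟨w, hw⟩ := exists_proj_eq X (r • proj X _ u)
  let E (V : FGProj R) : X.X.obj V →+ X.X.obj V := AddMonoidHom.mk'
    (fun x => X.X.bracket w (aug X V x) + incl X V (r • rem hu V x))
    (fun x y => by
      rw [rem_add, smul_add, smul_add, map_add, map_add, ← bracket_defect_of_proj_eq_smul hu hw,
        map_add]
      abel)
  let f : End X.X :=
    { app := fun V => intHom (E V)
      naturality := fun V W g => ModuleCat.hom_ext (LinearMap.ext fun x => by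
        change X.X.bracket w (aug X W ((X.X.map g).hom x)) +
          incl X W (r • rem hu W ((X.X.map g).hom x)) =
          (X.X.map g).hom (X.X.bracket w (aug X V x) + incl X V (r • rem hu V x))
        rw [map_add, map_incl, ProjFunctor.map_bracket, aug_map, (φ.C₁.map g).hom.map_smul, map_rem]) }
  refine ⟨f, fun V c => ?_, fun V x => ?_⟩
  · change X.X.bracket w (aug X V (incl X V c)) + incl X V (r • rem hu V (incl X V c)) = _
    rw [aug_incl, ProjFunctor.bracket_zero X.pointed, rem_incl, zero_add]
  · change proj X V (X.X.bracket w (aug X V x) + incl X V (r • rem hu V x)) = _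
    rw [map_add, proj_bracket, hw, proj_incl, map_smul, d_rem, ProjFunctor.bracket, map_smul,
      ← smul_add]
    congr 1
    exact add_sub_cancel _ _

/-- Over `0`, the endomorphism kills `C₁` and sends `u` into `Ker c₀`, that is, into `M ⊗_R R`.
Writing `f(u)` as `m ⊗ 1` identifies `f` with `i(m)`, as both agree at `u` and on `C₁`. -/
theorem mem_range_regularIncl {f : regularRing X} (hf : regularProj X f = 0) :
    ∃ m, regularIncl X m = f := by
  have h := regularProj_spec X f
  rw [hf] at h
  obtain ⟨y, hy⟩ := exists_inclBimod X (x := act X f.1 _ u) (by rw [h.2, zero_smul])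
  obtain ⟨m, rfl⟩ : ∃ m, bimodMk m (𝟙_ (FGProj R)) (1 : R) = y := by
    clear hy
    induction y using bimodTensor_induction with
    | h0 => exact ⟨0, TensorProduct.zero_tmul _ _⟩
    | hadd x y hx hy =>
      obtain ⟨m, rfl⟩ := hx
      obtain ⟨m', rfl⟩ := hy
      exact ⟨m + m', bimodMk_add m m' _ _⟩
    | h m r =>
      -- This is `m r ⊗ 1 = m ⊗ r`.
      refine ⟨op (r : R) • m, (TensorProduct.smul_tmul (R := Rᵐᵒᵖ) (op (r : R)) m _).trans ?_⟩
      exact congrArg (fun s : R => bimodMk m (𝟙_ (FGProj R)) s) (mul_one (r : R))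
  refine ⟨m, Subtype.ext (end_ext hu ?_ fun V c => ?_)⟩
  · exact (congrArg (fun s : R => inclBimod X _ (bimodMk m (𝟙_ (FGProj R)) s)) hu).trans hy
  · exact ((kernelEnd_regular X m).1 V c).trans (h.1 V c).symm

/-- The map `i(m)` factors as `X → C₀ → I → I(M) → C₁ → X`. Precomposing with an endomorphism over
`r` multiplies by `r` on `C₀`, and `m ⊗ r v = m r ⊗ v`; postcomposing multiplies by `r` on `C₁`, and
`r (m ⊗ v) = r m ⊗ v`. Products of two such maps vanish because the image lies in `C₁`, which `i(m)`
kills. -/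
theorem isSquareZeroExtension : IsSquareZeroExtension (regularIncl X) (regularProj X) where
  injective m m' h := by
    have h1 : act X (kernelEnd X m) _ u = act X (kernelEnd X m') _ u := by
      rw [show kernelEnd X m = kernelEnd X m' from congrArg Subtype.val h]
    have h2 := φ.b_injective _ (incl_injective X _ h1)
    have h3 : bimodMk m (𝟙_ (FGProj R)) (1 : R) = bimodMk m' (𝟙_ (FGProj R)) (1 : R) := by
      have e : aug X (𝟙_ (FGProj R)) u = (1 : R) := hu
      rw [← e]
      exact h2
    exact bimodMk_one_injective h3
  exact f := ⟨mem_range_regularIncl hu, by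
    rintro ⟨m, rfl⟩
    exact (regularProj_spec X _).unique (kernelEnd_regular X m)⟩
  surjective r := by
    obtain ⟨f, hf⟩ := exists_regularOver hu r
    exact ⟨⟨f, r, hf⟩, (regularProj_spec X _).unique hf⟩
  right m f := by
    refine Subtype.ext (act_ext X fun V x => ?_)
    change act X (kernelEnd X m) V (act X f.1 V x) = act X (kernelEnd X _) V x
    rw [act_kernelEnd, act_kernelEnd, (regularProj_spec X f).2, map_smul]
    congr 2
    exact (TensorProduct.smul_tmul (R := Rᵐᵒᵖ) (op (regularProj X f)) m _).symm
  left m f := by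
    refine Subtype.ext (act_ext X fun V x => ?_)
    change act X f.1 V (act X (kernelEnd X m) V x) = act X (kernelEnd X _) V x
    rw [act_kernelEnd, act_kernelEnd, (regularProj_spec X f).1, ← map_smul]
    congr 2
  square_zero m m' := by
    refine Subtype.ext (act_ext X fun V x => ?_)
    change act X (kernelEnd X m) V (act X (kernelEnd X m') V x) = 0
    rw [act_kernelEnd X m', (kernelEnd_regular X m).1, zero_smul, map_zero]

end Decomposition

end RingElemExt

end

/-! ### Products with brackets of the unit. -/

section

section Brackets

variable {R : Type u} [CommRing R] {S : Type w} [Ring S]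

namespace FGProj

/-- The element `v ⊗ w` of `V ⊗ W`. -/
def tmul {V W : FGProj R} (v : V.obj) (w : W.obj) : (V ⊗ W).obj := (tautMul R).mul V W v w

/-- The map `v ↦ v ⊗ w`. -/
def tensorRight (V : FGProj R) {W : FGProj R} (w : W.obj) : V ⟶ V ⊗ W :=
  (ρ_ V).inv ≫ (𝟙 V ⊗ₘ point w)

/-- The map `w ↦ v ⊗ w`. -/
def tensorLeft {V : FGProj R} (v : V.obj) (W : FGProj R) : W ⟶ V ⊗ W :=
  (λ_ W).inv ≫ (point v ⊗ₘ 𝟙 W)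

theorem tensorRight_apply {V W : FGProj R} (v : V.obj) (w : W.obj) :
    (tensorRight V w).hom.hom v = tmul v w := by
  change (v ⊗ₜ[R] ((1 : R) • w) : V.obj ⊗[R] W.obj) = v ⊗ₜ[R] w
  rw [one_smul]

theorem tensorLeft_apply {V W : FGProj R} (v : V.obj) (w : W.obj) :
    (tensorLeft v W).hom.hom w = tmul v w := by
  change (((1 : R) • v) ⊗ₜ[R] w : V.obj ⊗[R] W.obj) = v ⊗ₜ[R] w
  rw [one_smul]

theorem tmul_add {V W : FGProj R} (v : V.obj) (w w' : W.obj) :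
    tmul v (w + w') = tmul v w + tmul v w' := map_add _ _ _

theorem add_tmul {V W : FGProj R} (v v' : V.obj) (w : W.obj) :
    tmul (v + v') w = tmul v w + tmul v' w := by
  rw [tmul, map_add]; rfl

theorem tmul_zero {V W : FGProj R} (v : V.obj) : tmul v (0 : W.obj) = 0 := map_zero _

theorem zero_tmul {V W : FGProj R} (w : W.obj) : tmul (0 : V.obj) w = 0 := by
  rw [tmul, map_zero]; rfl

theorem map_tmul {V V' W W' : FGProj R} (f : V ⟶ V') (g : W ⟶ W') (v : V.obj) (w : W.obj) :
    (f ⊗ₘ g).hom.hom (tmul v w) = tmul (f.hom.hom v) (g.hom.hom w) := rfl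

end FGProj

namespace FunctorMul

variable {F : ProjFunctor R S} (ν : FunctorMul F)

theorem mul_unit {V : FGProj R} (x : F.obj V) :
    ν.mul V (𝟙_ _) x ν.one = (F.map (ρ_ V).inv).hom x := by
  conv_rhs => rw [← ν.mul_one V x, ProjFunctor.map_map_apply, Iso.hom_inv_id,
    ProjFunctor.map_id_apply]

theorem unit_mul {V : FGProj R} (x : F.obj V) :
    ν.mul (𝟙_ _) V ν.one x = (F.map (λ_ V).inv).hom x := by
  conv_rhs => rw [← ν.one_mul V x, ProjFunctor.map_map_apply, Iso.hom_inv_id,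
    ProjFunctor.map_id_apply]

/-- Functoriality in the second factor reduces the product with `[w]` to the product with the unit.
Hence multiplication by `[w]` is the effect of a morphism of `R-proj`, and commutes with every
natural transformation. -/
theorem mul_bracket {V W : FGProj R} (x : F.obj V) (w : W.obj) :
    ν.mul V W x (F.bracket ν.one w) = (F.map (FGProj.tensorRight V w)).hom x := by
  have := ν.map_mul (𝟙 V) (FGProj.point w) x ν.one
  rw [ProjFunctor.map_id_apply, mul_unit, ProjFunctor.map_map_apply] at this
  exact this.symm

theorem bracket_mul {V W : FGProj R} (v : V.obj) (y : F.obj W) :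
    ν.mul V W (F.bracket ν.one v) y = (F.map (FGProj.tensorLeft v W)).hom y := by
  have := ν.map_mul (FGProj.point v) (𝟙 W) ν.one y
  rw [ProjFunctor.map_id_apply, unit_mul, ProjFunctor.map_map_apply] at this
  exact this.symm

theorem bracket_mul_bracket {V W : FGProj R} (v : V.obj) (w : W.obj) :
    ν.mul V W (F.bracket ν.one v) (F.bracket ν.one w) = F.bracket ν.one (FGProj.tmul v w) := by
  rw [mul_bracket, ProjFunctor.map_bracket, FGProj.tensorRight_apply]

end FunctorMul

namespace ComplexMul

variable {F₁ F₀ : ProjFunctor R S} {d : F₁ ⟶ F₀} (ν : ComplexMul d)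

theorem mul₁₀_bracket {V W : FGProj R} (c : F₁.obj V) (w : W.obj) :
    ν.mul₁₀ V W c (F₀.bracket ν.one w) = (F₁.map (FGProj.tensorRight V w)).hom c := by
  have h : ν.mul₁₀ V (𝟙_ _) c ν.one = (F₁.map (ρ_ V).inv).hom c := by
    conv_rhs => rw [← ν.mul₁₀_one V c, ProjFunctor.map_map_apply, Iso.hom_inv_id,
      ProjFunctor.map_id_apply]
  have := ν.map_mul₁₀ (𝟙 V) (FGProj.point w) c ν.one
  rw [ProjFunctor.map_id_apply, h, ProjFunctor.map_map_apply] at this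
  exact this.symm

theorem bracket_mul₀₁ {V W : FGProj R} (v : V.obj) (c : F₁.obj W) :
    ν.mul₀₁ V W (F₀.bracket ν.one v) c = (F₁.map (FGProj.tensorLeft v W)).hom c := by
  have h : ν.mul₀₁ (𝟙_ _) W ν.one c = (F₁.map (λ_ W).inv).hom c := by
    conv_rhs => rw [← ν.one_mul₀₁ W c, ProjFunctor.map_map_apply, Iso.hom_inv_id,
      ProjFunctor.map_id_apply]
  have := ν.map_mul₀₁ (FGProj.point v) (𝟙 W) ν.one c
  rw [ProjFunctor.map_id_apply, h, ProjFunctor.map_map_apply] at this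
  exact this.symm

end ComplexMul

end Brackets

variable {R : Type u} [CommRing R] {M : Type u} [AddCommGroup M] [Module R M] [Module Rᵐᵒᵖ M]
  [SMulCommClass R Rᵐᵒᵖ M]

/-! ### Construction of a multiplicative structure on a splitting. -/

namespace RingElemExt

variable {φ : RingElemExt R M} (μ : φ.Mul (tautMul R)) {X : φ.eStar.Splitting}
  {u : X.X.obj (𝟙_ (FGProj R))}

theorem aug_of_proj_eq_one (h : proj X _ u = μ.one) : aug X _ u = (1 : R) :=
  (congrArg (φ.a.app (𝟙_ _)).hom h).trans μ.a_one

variable {μ} (h : proj X _ u = μ.one) (hu : aug X _ u = (1 : R))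

include h

theorem mul₁₀_defect {V W : FGProj R} (v v' : V.obj) (w : W.obj) :
    μ.mul₁₀ V W (defect hu V v v') (φ.C₀.bracket (proj X _ u) w) =
      defect hu (V ⊗ W) (FGProj.tmul v w) (FGProj.tmul v' w) := by
  rw [h, ComplexMul.mul₁₀_bracket, map_defect, FGProj.tensorRight_apply, FGProj.tensorRight_apply]

theorem mul₀₁_defect {V W : FGProj R} (v : V.obj) (w w' : W.obj) :
    μ.mul₀₁ V W (φ.C₀.bracket (proj X _ u) v) (defect hu W w w') =
      defect hu (V ⊗ W) (FGProj.tmul v w) (FGProj.tmul v w') := by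
  rw [h, ComplexMul.bracket_mul₀₁, map_defect, FGProj.tensorLeft_apply, FGProj.tensorLeft_apply]

omit h

variable (μ)

/-- The product of two elements of a splitting, in terms of the decomposition given by `u`. -/
def splitMul {V W : FGProj R} (x : X.X.obj V) (y : X.X.obj W) : X.X.obj (V ⊗ W) :=
  X.X.bracket u (FGProj.tmul (aug X V x) (aug X W y)) +
    incl X (V ⊗ W) (μ.mul₀₁ V W (proj X V x) (rem hu W y) +
      μ.mul₁₀ V W (rem hu V x) (φ.C₀.bracket (proj X _ u) (aug X W y)))

/-- The two expressions differ by the Leibniz relation `d(c) c' = c d(c')` for the `C₁`-components,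
where `d(c) = c₀(x) - [aug x]`. The definition is suited to additivity in `x`, this form to
additivity in `y`. -/
theorem splitMul_eq {V W : FGProj R} (x : X.X.obj V) (y : X.X.obj W) :
    splitMul μ hu x y = X.X.bracket u (FGProj.tmul (aug X V x) (aug X W y)) +
      incl X (V ⊗ W) (μ.mul₀₁ V W (φ.C₀.bracket (proj X _ u) (aug X V x)) (rem hu W y) +
        μ.mul₁₀ V W (rem hu V x) (proj X W y)) := by
  have e := μ.leibniz₁₁ V W (rem hu V x) (rem hu W y)
  rw [d_rem, d_rem, map_sub, map_sub, AddMonoidHom.sub_apply, sub_sub_sub_comm, sub_eq_zero,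
    sub_eq_sub_iff_add_eq_add] at e
  rw [splitMul, e]

variable {μ}

include h

/-- The defect in the `C₁`-component of `x + x'`, multiplied by `[aug y]`, is the defect of the
tensors `aug x ⊗ aug y` and `aug x' ⊗ aug y`, and cancels the non-additivity of the bracket term. -/
theorem splitMul_add_left {V W : FGProj R} (x x' : X.X.obj V) (y : X.X.obj W) :
    splitMul μ hu (x + x') y = splitMul μ hu x y + splitMul μ hu x' y := by
  simp only [splitMul, map_add, rem_add, AddMonoidHom.add_apply, FGProj.add_tmul,
    mul₁₀_defect h hu, incl_defect]
  abel

theorem splitMul_add_right {V W : FGProj R} (x : X.X.obj V) (y y' : X.X.obj W) :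
    splitMul μ hu x (y + y') = splitMul μ hu x y + splitMul μ hu x y' := by
  simp only [splitMul_eq, map_add, rem_add, FGProj.tmul_add, mul₀₁_defect h hu, incl_defect]
  abel

omit h

theorem splitMul_incl {V W : FGProj R} (x : X.X.obj V) (c : φ.C₁.obj W) :
    splitMul μ hu x (incl X W c) = incl X (V ⊗ W) (μ.mul₀₁ V W (proj X V x) c) := by
  rw [splitMul, aug_incl, rem_incl, FGProj.tmul_zero, ProjFunctor.bracket_zero X.pointed,
    ProjFunctor.bracket_zero φ.pointed₀, map_zero, zero_add, add_zero]

theorem incl_splitMul {V W : FGProj R} (c : φ.C₁.obj V) (y : X.X.obj W) :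
    splitMul μ hu (incl X V c) y = incl X (V ⊗ W) (μ.mul₁₀ V W c (proj X W y)) := by
  rw [splitMul_eq, aug_incl, rem_incl, FGProj.zero_tmul, ProjFunctor.bracket_zero X.pointed,
    ProjFunctor.bracket_zero φ.pointed₀, map_zero, AddMonoidHom.zero_apply, zero_add, zero_add]

theorem bracket_splitMul_bracket {V W : FGProj R} (v : V.obj) (w : W.obj) :
    splitMul μ hu (X.X.bracket u v) (X.X.bracket u w) = X.X.bracket u (FGProj.tmul v w) := by
  rw [splitMul, rem_bracket, rem_bracket, aug_bracket hu, aug_bracket hu, map_zero, map_zero,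
    AddMonoidHom.zero_apply, add_zero, map_zero, add_zero]

theorem map_splitMul {V V' W W' : FGProj R} (f : V ⟶ V') (g : W ⟶ W') (x : X.X.obj V)
    (y : X.X.obj W) : (X.X.map (f ⊗ₘ g)).hom (splitMul μ hu x y) =
      splitMul μ hu ((X.X.map f).hom x) ((X.X.map g).hom y) := by
  rw [splitMul, splitMul, map_add, ProjFunctor.map_bracket, map_incl, map_add, μ.map_mul₀₁,
    μ.map_mul₁₀, FGProj.map_tmul, ProjFunctor.map_bracket, map_rem, map_rem, aug_map, aug_map,
    proj_map]

include h

theorem proj_splitMul {V W : FGProj R} (x : X.X.obj V) (y : X.X.obj W) :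
    proj X (V ⊗ W) (splitMul μ hu x y) = μ.mul V W (proj X V x) (proj X W y) := by
  induction x using splitting_induction hu with
  | hi c => rw [incl_splitMul, proj_incl, proj_incl, μ.leibniz₁₀]
  | hadd x x' hx hx' => simp only [splitMul_add_left h, map_add, hx, hx', AddMonoidHom.add_apply]
  | hb v =>
    induction y using splitting_induction hu with
    | hi c => rw [splitMul_incl, proj_incl, proj_incl, μ.leibniz₀₁]
    | hadd y y' hy hy' => simp only [splitMul_add_right h, map_add, hy, hy']
    | hb w =>
      rw [bracket_splitMul_bracket, proj_bracket, proj_bracket, proj_bracket, h,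
        FunctorMul.bracket_mul_bracket]

/-- When a factor comes from `C₁`, this is one of the mixed associativity laws of `μ`; for three
brackets it is associativity of `⊗` on elements. -/
theorem splitMul_assoc {U V W : FGProj R} (x : X.X.obj U) (y : X.X.obj V) (z : X.X.obj W) :
    (X.X.map (α_ U V W).hom).hom (splitMul μ hu (splitMul μ hu x y) z) =
      splitMul μ hu x (splitMul μ hu y z) := by
  induction x using splitting_induction hu with
  | hi c =>
    rw [incl_splitMul, incl_splitMul, incl_splitMul, map_incl, μ.assoc₁₀₀, proj_splitMul h]
  | hadd x x' hx hx' => simp only [splitMul_add_left h, map_add, hx, hx']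
  | hb u' =>
    induction y using splitting_induction hu with
    | hi c =>
      rw [splitMul_incl, incl_splitMul, incl_splitMul, splitMul_incl, map_incl, μ.assoc₀₁₀]
    | hadd y y' hy hy' => simp only [splitMul_add_left h, splitMul_add_right h, map_add, hy, hy']
    | hb v =>
      induction z using splitting_induction hu with
      | hi c =>
        rw [splitMul_incl, splitMul_incl, splitMul_incl, map_incl, proj_splitMul h, μ.assoc₀₀₁]
      | hadd z z' hz hz' => simp only [splitMul_add_right h, map_add, hz, hz']
      | hb w =>
        simp only [bracket_splitMul_bracket, ProjFunctor.map_bracket]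
        rfl

theorem unit_splitMul {V : FGProj R} (x : X.X.obj V) :
    (X.X.map (λ_ V).hom).hom (splitMul μ hu u x) = x := by
  induction x using splitting_induction hu with
  | hi c => rw [splitMul_incl, map_incl, h, μ.one_mul₀₁]
  | hadd x x' hx hx' => simp only [splitMul_add_right h, map_add, hx, hx']
  | hb v =>
    have e := bracket_splitMul_bracket (μ := μ) hu (V := 𝟙_ (FGProj R)) (1 : R) v
    rw [ProjFunctor.bracket_one] at e
    rw [e, ProjFunctor.map_bracket]
    exact congrArg (X.X.bracket u) ((tautMul R).one_mul V v)

theorem splitMul_unit {V : FGProj R} (x : X.X.obj V) :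
    (X.X.map (ρ_ V).hom).hom (splitMul μ hu x u) = x := by
  induction x using splitting_induction hu with
  | hi c => rw [incl_splitMul, map_incl, h, μ.mul₁₀_one]
  | hadd x x' hx hx' => simp only [splitMul_add_left h, map_add, hx, hx']
  | hb v =>
    have e := bracket_splitMul_bracket (μ := μ) hu (W := 𝟙_ (FGProj R)) v (1 : R)
    rw [ProjFunctor.bracket_one] at e
    rw [e, ProjFunctor.map_bracket]
    exact congrArg (X.X.bracket u) ((tautMul R).mul_one V v)

theorem nonempty_splitting_mul : Nonempty (X.Mul (μ.restrict (Int.castRingHom R))) := by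
  have hu := aug_of_proj_eq_one μ h
  let m (V W : FGProj R) : X.X.obj V →+ X.X.obj W →+ X.X.obj (V ⊗ W) := AddMonoidHom.mk'
    (fun x => AddMonoidHom.mk' (splitMul μ hu x) (splitMul_add_right h hu x))
    (fun x x' => AddMonoidHom.ext fun y => splitMul_add_left h hu x x' y)
  let ν : ComplexMul X.c₁ :=
    { one := u
      mul := m
      -- Over the integers, bilinearity is automatic from biadditivity.
      smul_mul := fun V W s x y => by
        simpa using map_intCast_smul ((m V W).flip y) ℤ ℤ s x
      mul_smul := fun V W s x y => by
        simpa using map_intCast_smul (m V W x) ℤ ℤ s y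
      map_mul := map_splitMul hu
      assoc := fun _ _ _ => splitMul_assoc h hu
      one_mul := fun _ => unit_splitMul h hu
      mul_one := fun _ => splitMul_unit h hu
      -- The mixed products are forced: `(id, c₀)` must be multiplicative.
      mul₀₁ := fun V W => (μ.mul₀₁ V W).comp (proj X V)
      mul₁₀ := fun V W => (AddMonoidHom.compHom' (proj X W)).comp (μ.mul₁₀ V W)
      smul_mul₀₁ := fun V W s x c => by
        refine (congrArg (fun t => μ.mul₀₁ V W t c) ((X.c₀.app V).hom.map_smul s x)).trans ?_
        exact (μ.restrict (Int.castRingHom R)).smul_mul₀₁ V W s _ _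
      mul₀₁_smul := fun V W s x c => (μ.restrict (Int.castRingHom R)).mul₀₁_smul V W s _ _
      smul_mul₁₀ := fun V W s c x => (μ.restrict (Int.castRingHom R)).smul_mul₁₀ V W s _ _
      mul₁₀_smul := fun V W s c x => by
        refine (congrArg (fun t => μ.mul₁₀ V W c t) ((X.c₀.app W).hom.map_smul s x)).trans ?_
        exact (μ.restrict (Int.castRingHom R)).mul₁₀_smul V W s _ _
      map_mul₀₁ := fun f g x c => (μ.map_mul₀₁ f g _ _).trans
        (congrArg (fun t => μ.mul₀₁ _ _ t _) (proj_map X f x).symm)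
      map_mul₁₀ := fun f g c x => (μ.map_mul₁₀ f g _ _).trans
        (congrArg (fun t => μ.mul₁₀ _ _ _ t) (proj_map X g x).symm)
      assoc₀₀₁ := fun U V W x y c => (congrArg (fun t => (φ.C₁.map (α_ U V W).hom).hom
        (μ.mul₀₁ _ _ t c)) (proj_splitMul h hu x y)).trans (μ.assoc₀₀₁ U V W _ _ c)
      assoc₀₁₀ := fun U V W x c y => μ.assoc₀₁₀ U V W _ c _
      assoc₁₀₀ := fun U V W c x y => (μ.assoc₁₀₀ U V W c _ _).trans
        (congrArg (fun t => μ.mul₁₀ _ _ c t) (proj_splitMul h hu x y).symm)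
      one_mul₀₁ := fun V c => (congrArg (fun t => (φ.C₁.map (λ_ V).hom).hom
        (μ.mul₀₁ _ _ t c)) h).trans (μ.one_mul₀₁ V c)
      mul₁₀_one := fun V c => (congrArg (fun t => (φ.C₁.map (ρ_ V).hom).hom
        (μ.mul₁₀ _ _ c t)) h).trans (μ.mul₁₀_one V c)
      leibniz₀₁ := fun V W x c => (splitMul_incl hu x c).symm
      leibniz₁₀ := fun V W c x => (incl_splitMul hu c x).symm
      leibniz₁₁ := fun V W c c' => by
        refine Eq.trans ?_ (μ.leibniz₁₁ V W c c')
        exact congrArg₂ (fun s t => μ.mul₀₁ V W s c' - μ.mul₁₀ V W c t)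
          (proj_incl X V c) (proj_incl X W c') }
  exact ⟨{
    toComplexMul := ν
    c₀_one := h
    c₀_mul := fun V W => proj_splitMul h hu
    id_mul₀₁ := fun _ _ _ _ => rfl
    id_mul₁₀ := fun _ _ _ _ => rfl }⟩

end RingElemExt

end

/-! ### Regular endomorphisms and products: commutativity of `R'` and linearity over it. -/

section

variable {R : Type u} [CommRing R] {M : Type u} [AddCommGroup M] [Module R M] [Module Rᵐᵒᵖ M]
  [SMulCommClass R Rᵐᵒᵖ M]

namespace RingElemExt

variable {φ : RingElemExt R M} {μ : φ.Mul (tautMul R)} {X : φ.eStar.Splitting}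
  (ν : X.Mul (μ.restrict (Int.castRingHom R)))

theorem aug_mul_one : aug X _ ν.one = (1 : R) := aug_of_proj_eq_one μ ν.c₀_one

theorem mul_incl {V W : FGProj R} (x : X.X.obj V) (c : φ.C₁.obj W) :
    ν.mul V W x (incl X W c) = incl X (V ⊗ W) (μ.mul₀₁ V W (proj X V x) c) :=
  (ν.leibniz₀₁ V W x c).symm.trans (congrArg (incl X (V ⊗ W)) (ν.id_mul₀₁ V W x c))

theorem incl_mul {V W : FGProj R} (c : φ.C₁.obj V) (y : X.X.obj W) :
    ν.mul V W (incl X V c) y = incl X (V ⊗ W) (μ.mul₁₀ V W c (proj X W y)) :=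
  (ν.leibniz₁₀ V W c y).symm.trans (congrArg (incl X (V ⊗ W)) (ν.id_mul₁₀ V W c y))

/-- For `y = [w]`, multiplication by `y` is induced by a morphism of `R-proj`, so it commutes with
the natural map `f`. For `y` in `C₁`, both sides are `r` times the product, by linearity of `μ` over
`R`. -/
theorem RegularOver.act_mul {f : End X.X} {r : R} (hf : RegularOver X f r) {V W : FGProj R}
    (x : X.X.obj V) (y : X.X.obj W) :
    ν.mul V W (act X f V x) y = act X f (V ⊗ W) (ν.mul V W x y) := by
  induction y using splitting_induction (aug_mul_one ν) with
  | hb w => rw [FunctorMul.mul_bracket, FunctorMul.mul_bracket, act_map]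
  | hi c => rw [mul_incl, mul_incl, hf.2, hf.1, μ.smul_mul₀₁]
  | hadd y y' hy hy' => rw [map_add, map_add, map_add, hy, hy']

theorem RegularOver.mul_act {f : End X.X} {r : R} (hf : RegularOver X f r) {V W : FGProj R}
    (x : X.X.obj V) (y : X.X.obj W) :
    ν.mul V W x (act X f W y) = act X f (V ⊗ W) (ν.mul V W x y) := by
  induction x using splitting_induction (aug_mul_one ν) with
  | hb v => rw [FunctorMul.bracket_mul, FunctorMul.bracket_mul, act_map]
  | hi c => rw [incl_mul, incl_mul, hf.2, hf.1, μ.mul₁₀_smul]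
  | hadd x x' hx hx' =>
    rw [map_add, AddMonoidHom.add_apply, AddMonoidHom.add_apply, map_add, hx, hx']

-- Eckmann–Hilton: `f(g(1·1))` and `g(f(1·1))` both equal `f(1)·g(1)`, so the two composites agree
-- at the unit. On `C₁` they agree because `R` is commutative, and these values determine an
-- endomorphism.
include ν in
theorem regularRing_mul_comm (f g : regularRing X) : f * g = g * f := by
  have hf := regularProj_spec X f
  have hg := regularProj_spec X g
  refine Subtype.ext (end_ext (aug_mul_one ν) ?_ fun V c => ?_)
  · change act X f.1 _ (act X g.1 _ ν.one) = act X g.1 _ (act X f.1 _ ν.one)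
    have e : act X f.1 _ (act X g.1 _ (ν.mul _ _ ν.one ν.one)) =
        act X g.1 _ (act X f.1 _ (ν.mul _ _ ν.one ν.one)) := by
      rw [← hg.mul_act, ← hf.act_mul, ← hf.act_mul, ← hg.mul_act]
    have e' := congrArg (X.X.map (λ_ (𝟙_ (FGProj R))).hom).hom e
    rwa [← act_map, ← act_map, ← act_map, ← act_map, ν.one_mul] at e'
  · change act X f.1 _ (act X g.1 _ _) = act X g.1 _ (act X f.1 _ _)
    rw [hg.1, hf.1, hf.1, hg.1, smul_comm]

/-- The multiplicative structure over `R'` on `X` with the products of `ν`. -/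
def regularMul : (regularSplitting X).Mul (μ.restrict (regularProj X)) where
  one := ν.one
  mul := ν.mul
  smul_mul _ _ f x y := (regularProj_spec X f).act_mul ν x y
  mul_smul _ _ f x y := (regularProj_spec X f).mul_act ν x y
  map_mul := ν.map_mul
  assoc := ν.assoc
  one_mul := ν.one_mul
  mul_one := ν.mul_one
  mul₀₁ V W := ν.mul₀₁ V W
  mul₁₀ V W := ν.mul₁₀ V W
  smul_mul₀₁ V W f x c := by
    refine (ν.id_mul₀₁ V W _ c).trans (Eq.trans ?_
      (congrArg (fun t : φ.C₁.obj (V ⊗ W) => regularProj X f • t) (ν.id_mul₀₁ V W x c).symm))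
    exact (congrArg (fun t => μ.mul₀₁ V W t c) ((regularProj_spec X f).2 V x)).trans
      (μ.smul_mul₀₁ V W _ _ _)
  mul₀₁_smul V W f x c := by
    refine (ν.id_mul₀₁ V W x _).trans (Eq.trans ?_
      (congrArg (fun t : φ.C₁.obj (V ⊗ W) => regularProj X f • t) (ν.id_mul₀₁ V W x c).symm))
    exact μ.mul₀₁_smul V W _ _ _
  smul_mul₁₀ V W f c x := by
    refine (ν.id_mul₁₀ V W _ x).trans (Eq.trans ?_
      (congrArg (fun t : φ.C₁.obj (V ⊗ W) => regularProj X f • t) (ν.id_mul₁₀ V W c x).symm))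
    exact μ.smul_mul₁₀ V W _ _ _
  mul₁₀_smul V W f c x := by
    refine (ν.id_mul₁₀ V W c _).trans (Eq.trans ?_
      (congrArg (fun t : φ.C₁.obj (V ⊗ W) => regularProj X f • t) (ν.id_mul₁₀ V W c x).symm))
    exact (congrArg (fun t => μ.mul₁₀ V W c t) ((regularProj_spec X f).2 W x)).trans
      (μ.mul₁₀_smul V W _ _ _)
  map_mul₀₁ := ν.map_mul₀₁
  map_mul₁₀ := ν.map_mul₁₀
  assoc₀₀₁ := ν.assoc₀₀₁
  assoc₀₁₀ := ν.assoc₀₁₀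
  assoc₁₀₀ := ν.assoc₁₀₀
  one_mul₀₁ := ν.one_mul₀₁
  mul₁₀_one := ν.mul₁₀_one
  leibniz₀₁ := ν.leibniz₀₁
  leibniz₁₀ := ν.leibniz₁₀
  leibniz₁₁ := ν.leibniz₁₁
  c₀_one := ν.c₀_one
  c₀_mul := ν.c₀_mul
  id_mul₀₁ := ν.id_mul₀₁
  id_mul₁₀ := ν.id_mul₁₀

end RingElemExt

end

end

theorem mainTheorem6 (R : Type u) [CommRing R] (M : Type u) [AddCommGroup M] [Module R M]
    [Module Rᵐᵒᵖ M] [SMulCommClass R Rᵐᵒᵖ M]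
    (φ : RingElemExt R M) (μ : φ.Mul (tautMul R)) :
    Nonempty φ.eStar.Splitting ∧
    ∀ X : φ.eStar.Splitting,
      IsSquareZeroExtension (RingElemExt.regularIncl X) (RingElemExt.regularProj X) ∧
      (∀ x y : RingElemExt.regularRing X, x * y = y * x) ∧
      Nonempty (X.Mul (μ.restrict (Int.castRingHom R))) ∧
      ∀ ν : X.Mul (μ.restrict (Int.castRingHom R)),
        ∃ ν' : (RingElemExt.regularSplitting X).Mul (μ.restrict (RingElemExt.regularProj X)),
          ν'.one = ν.one ∧
          ∀ (V W : FGProj R) (x : X.X.obj V) (y : X.X.obj W), ν'.mul V W x y = ν.mul V W x y := by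
  refine ⟨φ.nonempty_splitting μ.a_one, fun X => ?_⟩
  -- The square-zero extension needs only that `u` lies over `1 ∈ R`; lifting the unit of `C₀`
  -- itself is what lets `u` serve as the unit of a product on `X`.
  obtain ⟨u, hu⟩ := RingElemExt.exists_proj_eq X μ.one
  have h := RingElemExt.nonempty_splitting_mul hu
  exact ⟨RingElemExt.isSquareZeroExtension (RingElemExt.aug_of_proj_eq_one μ hu),
    h.elim RingElemExt.regularRing_mul_comm, h,
    fun ν => ⟨RingElemExt.regularMul ν, rfl, fun _ _ _ _ => rfl⟩⟩
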